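/- Notation. $e_1=(1,0)$, $e_2=(0,1)$, and $\mathrm{Exp}(r)$ is the exponential distribution with rate $r>0$. Fix $u\in\mathbb Z^2$ and real weights $\{\omega_x : x\in u+\mathbb Z_{>0}^2\}$ (bulk weights). For $x\le y$ (coordinatewise) in $u+\mathbb Z_{>0}^2$ let $G_{x,y}=\max\sum_{k=0}^{n}\omega_{x_k}$, $n=|y-x|_1$, where the maximum is over nearest-neighbor up-right paths $x=x_0,x_1,\dots,x_n=y$ with $x_{k+1}-x_k\in\{e_1,e_2\}$. Given boundary weights $\{I^\alpha_{u+ie_1},J^\alpha_{u+je_2}: i,j\ge 1\}$, the process $G^\alpha_{u,x}$, $x\in u+\mathbb Z_{\ge0}^2$, is defined by $G^\alpha_{u,u}=0$, $G^\alpha_{u,u+ke_1}=\sum_{i=1}^k I^\alpha_{u+ie_1}$, $G^\alpha_{u,u+le_2}=\sum_{j=1}^l J^\alpha_{u+je_2}$ for $k,l\ge1$, and for $x=(x_1,x_2)\in u+\mathbb Z_{>0}^2$ $$G^\alpha_{u,x}=\max_{1\le k\le x_1-u_1}\Bigl\{\sum_{i=1}^k I^\alpha_{u+ie_1}+G_{u+ke_1+e_2,x}\Bigr\}\vee\max_{1\le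 l\le x_2-u_2}\Bigl\{\sum_{j=1}^l J^\alpha_{u+je_2}+G_{u+e_1+le_2,x}\Bigr\}.$$ Its increments are $I^\alpha_x=G^\alpha_{u,x}-G^\alpha_{u,x-e_1}$ and $J^\alpha_x=G^\alpha_{u,x}-G^\alpha_{u,x-e_2}$, whenever both points lie in $u+\mathbb Z_{\ge0}^2$ (on the axes these agree with the boundary weights). **Theorem 3.1.** Let $0<\lambda<\rho<1$ and $u\in\mathbb Z^2$. There is a coupling of the boundary weights $\{I^\lambda_{u+ie_1},I^\rho_{u+ie_1},J^\lambda_{u+je_2},J^\rho_{u+je_2}: i,j\ge1\}$, jointly independent of i.i.d. $\mathrm{Exp}(1)$ bulk weights $\{\omega_x:x\in u+\mathbb Z_{>0}^2\}$, such that the processes $G^\lambda_{u,\cdot}$ and $G^\rho_{u,\cdot}$ built from these boundary weights and the same bulk weights $\omega$ have the following properties. (i) (Joint) For each $v\in u+\mathbb Z_{\ge0}^2$, $$\bigl\{(G^\lambda_{u,v+x}-G^\lambda_{u,v},\,G^\rho_{u,v+x}-G^\rho_{u,v}):x\in\mathbb Z_{\ge0}^2\bigr\}\overset{d}{=}\bigl\{(G^\lambda_{u,u+x},\,G^\rho_{u,u+x}):x\in\mathbb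 Z_{\ge0}^2\bigr\}.$$ Moreover, for each $x\in u+\mathbb Z_{>0}^2$, the random variables $\{J^\lambda_{x+je_2}:u_2-x_2+1\le j\le0\}$ and $\{J^\rho_{x+je_2}:j\ge1\}$ together form a mutually independent family. (ii) (Marginal) For each $\alpha\in\{\lambda,\rho\}$ and each $v\in u+\mathbb Z_{\ge0}^2$, the random variables $\{I^\alpha_{v+ie_1},J^\alpha_{v+je_2}:i,j\ge1\}$ are mutually independent, with $I^\alpha_{v+ie_1}\sim\mathrm{Exp}(1-\alpha)$ and $J^\alpha_{v+je_2}\sim\mathrm{Exp}(\alpha)$. Likewise, the random variables $\{I^\alpha_{v-ie_1},J^\alpha_{v-je_2}:0\le i<v_1-u_1,\ 0\le j<v_2-u_2\}$ are mutually independent, with $I^\alpha_{v-ie_1}\sim\mathrm{Exp}(1-\alpha)$ and $J^\alpha_{v-je_2}\sim\mathrm{Exp}(\alpha)$. -/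

import Mathlib

open MeasureTheory ProbabilityTheory

namespace StatLPP

/-- The lattice vector `e₁`. -/
def e1 : ℤ × ℤ := (1, 0)

/-- The lattice vector `e₂`. -/
def e2 : ℤ × ℤ := (0, 1)

/-- The `ℓ¹` norm of a lattice point. -/
def norm1 (x : ℤ × ℤ) : ℕ := x.1.natAbs + x.2.natAbs

/-- `p 0, …, p n` is a nearest-neighbor up-right lattice path from `x` to `y`
(the values `p k` with `n < k` are irrelevant). -/
def IsUpRightPath (x y : ℤ × ℤ) (n : ℕ) (p : ℕ → ℤ × ℤ) : Prop :=
  p 0 = x ∧ p n = y ∧ ∀ k < n, p (k + 1) = p k + e1 ∨ p (k + 1) = p k + e2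

/-- The set of weights `∑_{k=0}^n w (x_k)` of up-right paths from `x` to `y`, `n = |y - x|₁`. -/
def pathSums (w : ℤ × ℤ → ℝ) (x y : ℤ × ℤ) : Set ℝ :=
  {s | ∃ p : ℕ → ℤ × ℤ, IsUpRightPath x y (norm1 (y - x)) p ∧
    s = ∑ k ∈ Finset.range (norm1 (y - x) + 1), w (p k)}

/-- The last-passage value `G_{x,y}`, used for coordinatewise ordered `x ≤ y`; then the set of path
weights is finite and nonempty, and the supremum is a maximum. -/
noncomputable def lpp (w : ℤ × ℤ → ℝ) (x y : ℤ × ℤ) : ℝ := sSup (pathSums w x y)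

/-- The points of the open quadrant `u + ℤ_{>0}²`. -/
def bulk (u : ℤ × ℤ) : Set (ℤ × ℤ) := {x | u.1 < x.1 ∧ u.2 < x.2}

/-- The last-passage value `G_{u,x}`, `x ∈ u + ℤ_{≥0}²`, with bulk weights `w` on `bulk u` and
boundary weights on the two axes through `u`: `I i` is the weight at `u + (i + 1) e₁` and `J j` the
weight at `u + (j + 1) e₂`, for `i, j = 0, 1, 2, …`; there is no weight at `u`.

In the bulk, the index `k` (resp. `l`) below stands for an exit from the horizontal (resp. vertical)
axis at `u + (k + 1) e₁` (resp. `u + (l + 1) e₂`). -/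
noncomputable def blpp (w : ℤ × ℤ → ℝ) (I J : ℕ → ℝ) (u x : ℤ × ℤ) : ℝ :=
  if x.2 = u.2 then ∑ i ∈ Finset.range (x.1 - u.1).toNat, I i
  else if x.1 = u.1 then ∑ j ∈ Finset.range (x.2 - u.2).toNat, J j
  else max
    (⨆ k : Fin (x.1 - u.1).toNat,
      (∑ i ∈ Finset.range (k + 1), I i + lpp w (u + ((k : ℤ) + 1) • e1 + e2) x))
    (⨆ l : Fin (x.2 - u.2).toNat,
      (∑ j ∈ Finset.range (l + 1), J j + lpp w (u + e1 + ((l : ℤ) + 1) • e2) x))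

/-- The horizontal increment `I_x = G_x - G_{x - e₁}` of a random field `G`. -/
def incI {Ω : Type*} (G : ℤ × ℤ → Ω → ℝ) (x : ℤ × ℤ) (o : Ω) : ℝ := G x o - G (x - e1) o

/-- The vertical increment `J_x = G_x - G_{x - e₂}` of a random field `G`. -/
def incJ {Ω : Type*} (G : ℤ × ℤ → Ω → ℝ) (x : ℤ × ℤ) (o : Ω) : ℝ := G x o - G (x - e2) o

/-- The random field `x ↦ G_{u,x}` built from random bulk weights `w` and boundary weights
`I`, `J`. -/
noncomputable def field {Ω : Type*} (w : ℤ × ℤ → Ω → ℝ) (I J : ℕ → Ω → ℝ) (u : ℤ × ℤ) :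
    ℤ × ℤ → Ω → ℝ :=
  fun x o => blpp (fun y => w y o) (fun i => I i o) (fun j => J j o) u x

/-- `{X a} ∪ {Y b}` is a family of mutually independent random variables with `X a ∼ Exp(r)` and
`Y b ∼ Exp(s)`, where `Exp(r)` is the exponential law with rate `r`. -/
def IndepExp {Ω : Type*} [MeasurableSpace Ω] (P : Measure Ω) {A B : Type*}
    (X : A → Ω → ℝ) (Y : B → Ω → ℝ) (r s : ℝ) : Prop :=
  iIndepFun (Sum.elim X Y) P ∧
    (∀ a, HasLaw (X a) (expMeasure r) P) ∧ (∀ b, HasLaw (Y b) (expMeasure s) P)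

/-- The marginal property of the field `G` on `u + ℤ_{≥0}²` with parameter `α`. For each
`v ∈ u + ℤ_{≥0}²`, both the increments on the two half-lines up and to the right of `v` and
the increments on the two segments to the left of and down from `v` are independent
with `I ∼ Exp(1 - α)` and `J ∼ Exp(α)`. -/
def MarginalProperty {Ω : Type*} [MeasurableSpace Ω] (P : Measure Ω) (G : ℤ × ℤ → Ω → ℝ)
    (u : ℤ × ℤ) (α : ℝ) : Prop :=
  ∀ v : ℤ × ℤ, u ≤ v →
    IndepExp P (fun i : Set.Ici (1 : ℤ) => incI G (v + (i : ℤ) • e1))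
      (fun j : Set.Ici (1 : ℤ) => incJ G (v + (j : ℤ) • e2)) (1 - α) α ∧
    IndepExp P (fun i : Set.Ico (0 : ℤ) (v.1 - u.1) => incI G (v - (i : ℤ) • e1))
      (fun j : Set.Ico (0 : ℤ) (v.2 - u.2) => incJ G (v - (j : ℤ) • e2)) (1 - α) α

end StatLPP

/-!
The coupling is built from independent exponential variables: a sojourn time `W` at the corner, of
rate `ρ - λ`, and along each axis a sequence of services and a sequence of arrivals. On the
horizontal axis the services, of rate `1 - λ`, are the increments `I^λ`, and the departures of the
queue started from `W` are the increments `I^ρ`. On the vertical axis the services, of rate `ρ`, are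
the increments `J^ρ`, and the departures of the queue started from the same `W` are `J^λ`.

Everything rests on Burke's property of a single queueing step `(x, y, z) ↦ (z + (x - y)⁺,
z + (y - x)⁺, min x y)`, which preserves the law `Exp a ⊗ Exp b ⊗ Exp (a + b)`
(`measurePreserving_burke`). The step can be applied to any three coordinates with such rates of the
family of independent variables (`measurePreserving_move`). Both the queues on the axes and
last-passage percolation itself are compositions of such steps, so each finite set of increments in
question sits in distinct coordinates of a measure-preserving image of the family, and is
independent with known laws (`iIndepFun_of_finite_coordinates`). This gives the marginal statements
and the independence along vertical lines.

Joint stationarity under translation by `e₁` is obtained by exhibiting the same independent family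
at the new corner (`shiftRight`): the vertical services pass through the first column of bulk
weights, and the vertical arrivals pass through the dual weights which that leaves behind. This is
again a composition of queueing steps. That the new family generates the increments of the old
processes is an intertwining identity for queues in tandem (`departure_departure`), proved by an
induction along the column whose step is a piecewise linear identity. Translation by `e₂` follows by
reflection along the diagonal, which exchanges `(λ, ρ)` with `(1 - ρ, 1 - λ)`.

The last-passage values with boundary, defined through exit points, enter only through their
recursion (`blpp_eq_grow`).
-/

namespace StatLPP

/-! ### Burke's property of a single queue -/

/-- The local update of queueing theory: arrival `x`, sojourn `y` and service `z` become departure,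
new sojourn and dual service. It is an involution. -/
noncomputable def burke (p : ℝ × ℝ × ℝ) : ℝ × ℝ × ℝ :=
  (p.2.2 + max (p.1 - p.2.1) 0, p.2.2 + max (p.2.1 - p.1) 0, min p.1 p.2.1)

/-- In the coordinates `(x - y, y, z)` the map fixes `x - y` and is a swap followed by a
translation in the other two, so it preserves Lebesgue measure. -/
lemma measurePreserving_burke_volume :
    MeasurePreserving burke ((volume : Measure ℝ).prod ((volume : Measure ℝ).prod volume))
      ((volume : Measure ℝ).prod ((volume : Measure ℝ).prod volume)) := by
  let V : Measure ℝ := volume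
  have h1 : MeasurePreserving (fun p : (ℝ × ℝ) × ℝ => (id p.1, p.2 - p.1.1))
      ((V.prod V).prod V) ((V.prod V).prod V) :=
    (MeasurePreserving.id _).skew_product (g := fun (q : ℝ × ℝ) (x : ℝ) => x - q.1) (by fun_prop)
      (Filter.Eventually.of_forall fun q => (measurePreserving_sub_right volume q.1).map_eq)
  have h2 : MeasurePreserving
      (fun p : ℝ × (ℝ × ℝ) => (id p.1, (p.2.2 + max (-p.1) 0, p.2.1 - max (-p.1) 0)))
      (V.prod (V.prod V)) (V.prod (V.prod V)) := by
    refine (MeasurePreserving.id _).skew_product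
      (g := fun (t : ℝ) (q : ℝ × ℝ) => (q.2 + max (-t) 0, q.1 - max (-t) 0)) (by fun_prop)
      (Filter.Eventually.of_forall fun t => ?_)
    exact (((measurePreserving_add_right volume (max (-t) 0)).prod
      (measurePreserving_sub_right volume (max (-t) 0))).comp
        Measure.measurePreserving_swap).map_eq
  have h3 : MeasurePreserving (fun p : (ℝ × ℝ) × ℝ => (id p.1, p.2 + p.1.1))
      ((V.prod V).prod V) ((V.prod V).prod V) :=
    (MeasurePreserving.id _).skew_product (g := fun (q : ℝ × ℝ) (x : ℝ) => x + q.1) (by fun_prop)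
      (Filter.Eventually.of_forall fun q => (measurePreserving_add_right volume q.1).map_eq)
  have h := Measure.measurePreserving_swap.comp (h3.comp (Measure.measurePreserving_swap.comp
    (h2.comp (Measure.measurePreserving_swap.comp
      (h1.comp (Measure.measurePreserving_swap (μ := V) (ν := V.prod V)))))))
  convert h using 1
  funext ⟨x, y, z⟩
  simp only [burke, Function.comp, Prod.swap, id, Prod.mk.injEq]
  refine ⟨?_, ?_, ?_⟩ <;> rcases le_total x y with hxy | hxy <;>
    simp [hxy] <;> ring

lemma measurePreserving_withDensity {α : Type*} [MeasurableSpace α] {μ : Measure α} {T : α → α}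
    (hT : MeasurePreserving T μ μ) {f : α → ENNReal} (hf : Measurable f)
    (hfT : ∀ x, f (T x) = f x) :
    MeasurePreserving T (μ.withDensity f) (μ.withDensity f) := by
  refine ⟨hT.measurable, ?_⟩
  ext s hs
  rw [Measure.map_apply hT.measurable hs, withDensity_apply _ hs,
    withDensity_apply _ (hT.measurable hs), ← hT.setLIntegral_comp_preimage hs hf]
  simp [hfT]

/-- **Burke's property** of a single queue: with arrival rate `a`, sojourn rate `b` and service
rate `a + b`, the three outputs are independent with the same laws as the inputs. -/
lemma measurePreserving_burke {a b c : ℝ} (ha : 0 < a) (hb : 0 < b) (hc : a + b = c) :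
    MeasurePreserving burke ((expMeasure a).prod ((expMeasure b).prod (expMeasure c)))
      ((expMeasure a).prod ((expMeasure b).prod (expMeasure c))) := by
  have hm : ∀ r, Measurable (exponentialPDF r) := fun r =>
    (measurable_exponentialPDFReal r).ennreal_ofReal
  have he : ∀ r, expMeasure r = volume.withDensity (exponentialPDF r) := fun r => rfl
  have hp : ∀ r, 0 < r → IsProbabilityMeasure (volume.withDensity (exponentialPDF r)) :=
    fun r hr => isProbabilityMeasure_expMeasure hr
  have := hp a ha
  have := hp b hb
  have := hp c (by linarith)
  have hbc : Measurable fun z : ℝ × ℝ => exponentialPDF b z.1 * exponentialPDF c z.2 :=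
    ((hm b).comp measurable_fst).mul ((hm c).comp measurable_snd)
  rw [he, he, he, prod_withDensity (hm b) (hm c), prod_withDensity (hm a) hbc]
  refine measurePreserving_withDensity measurePreserving_burke_volume
    (((hm a).comp measurable_fst).mul (hbc.comp measurable_snd)) ?_
  rintro ⟨x, y, z⟩
  by_cases hpos : 0 ≤ x ∧ 0 ≤ y ∧ 0 ≤ z
  · obtain ⟨hx, hy, hz⟩ := hpos
    simp only [burke]
    have h1 : 0 ≤ z + max (x - y) 0 := by positivity
    have h2 : 0 ≤ z + max (y - x) 0 := by positivity
    have h3 : 0 ≤ min x y := le_min hx hy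
    simp only [exponentialPDF_of_nonneg, hx, hy, hz, h1, h2, h3]
    have hc0 : 0 < c := by linarith
    rw [← ENNReal.ofReal_mul (by positivity), ← ENNReal.ofReal_mul (by positivity),
      ← ENNReal.ofReal_mul (by positivity), ← ENNReal.ofReal_mul (by positivity)]
    congr 1
    have : ∀ p q r : ℝ, a * Real.exp (-(a * p)) * (b * Real.exp (-(b * q)) *
        (c * Real.exp (-(c * r)))) = a * b * c * Real.exp (-(a * p + b * q + c * r)) := by
      intro p q r
      rw [show -(a * p + b * q + c * r) = -(a * p) + (-(b * q) + -(c * r)) by ring,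
        Real.exp_add, Real.exp_add]
      ring
    rw [this, this]
    congr 3
    subst hc
    rcases le_total x y with h | h <;>
      simp [h] <;> ring
  · have hzero : ∀ p q r : ℝ, ¬(0 ≤ p ∧ 0 ≤ q ∧ 0 ≤ r) →
        exponentialPDF a p * (exponentialPDF b q * exponentialPDF c r) = 0 := by
      intro p q r h
      by_cases hp : 0 ≤ p
      · by_cases hq : 0 ≤ q
        · have hr : r < 0 := by
            by_contra hr; exact h ⟨hp, hq, not_lt.mp hr⟩
          simp [exponentialPDF_of_neg hr]
        · simp [exponentialPDF_of_neg (not_le.mp hq)]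
      · simp [exponentialPDF_of_neg (not_le.mp hp)]
    rw [hzero _ _ _ hpos, hzero]
    simp only [burke]
    rintro ⟨h1, h2, h3⟩
    obtain ⟨hx, hy⟩ := le_min_iff.mp h3
    refine hpos ⟨hx, hy, ?_⟩
    rcases le_total x y with h | h
    · rwa [max_eq_right (by linarith), add_zero] at h1
    · rwa [max_eq_right (by linarith), add_zero] at h2

/-! ### Queueing updates of a product measure -/

section Product

variable {K : Type*} [DecidableEq K]

/-- The queueing update acting on the coordinates `k₁` (arrival), `k₂` (sojourn), `k₃` (service) of
a configuration. -/
noncomputable def move (k₁ k₂ k₃ : K) (D : K → ℝ) : K → ℝ := fun k =>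
  if k = k₁ then D k₃ + max (D k₁ - D k₂) 0
  else if k = k₂ then D k₃ + max (D k₂ - D k₁) 0
  else if k = k₃ then min (D k₁) (D k₂)
  else D k

lemma measurable_move (k₁ k₂ k₃ : K) : Measurable (move k₁ k₂ k₃) := by
  refine measurable_pi_lambda _ fun k => ?_
  unfold move
  split_ifs <;> fun_prop

variable (ν : K → Measure ℝ) [∀ k, IsProbabilityMeasure (ν k)]

/-- Resampling one coordinate does not change a product measure. -/
lemma measurePreserving_update (k : K) :
    MeasurePreserving (fun p : ℝ × (K → ℝ) => Function.update p.2 k p.1)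
      ((ν k).prod (Measure.infinitePi ν)) (Measure.infinitePi ν) := by
  have hm : Measurable (fun p : ℝ × (K → ℝ) => Function.update p.2 k p.1) := by
    refine measurable_pi_lambda _ fun j => ?_
    by_cases h : j = k
    · subst h; simpa using measurable_fst
    · simp only [Function.update_of_ne h]; fun_prop
  refine ⟨hm, Measure.eq_infinitePi _ fun s t ht => ?_⟩
  rw [Measure.map_apply hm (.pi s.countable_toSet fun _ _ => ht _)]
  by_cases hk : k ∈ s
  · have : (fun p : ℝ × (K → ℝ) => Function.update p.2 k p.1) ⁻¹' (Set.pi s t) =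
        t k ×ˢ Set.pi (s.erase k : Finset K) t := by
      ext ⟨a, D⟩
      simp only [Set.mem_preimage, Set.mem_pi, Finset.mem_coe, Set.mem_prod, Finset.mem_erase]
      constructor
      · intro h
        refine ⟨by simpa using h k hk, fun j hj => ?_⟩
        simpa [Function.update_of_ne hj.1] using h j hj.2
      · rintro ⟨h1, h2⟩ j hj
        by_cases hjk : j = k
        · subst hjk; simpa using h1
        · simpa [Function.update_of_ne hjk] using h2 j ⟨hjk, hj⟩
    rw [this, Measure.prod_prod, Measure.infinitePi_pi _ fun i _ => ht i,
      Finset.mul_prod_erase s (fun i => ν i (t i)) hk]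
  · have : (fun p : ℝ × (K → ℝ) => Function.update p.2 k p.1) ⁻¹' (Set.pi s t) =
        Set.univ ×ˢ Set.pi s t := by
      ext ⟨a, D⟩
      simp only [Set.mem_preimage, Set.mem_pi, Finset.mem_coe, Set.mem_prod, Set.mem_univ,
        true_and]
      refine forall₂_congr fun j hj => ?_
      rw [Function.update_of_ne (by rintro rfl; exact hk hj)]
    rw [this, Measure.prod_prod, Measure.infinitePi_pi _ fun i _ => ht i]
    simp

lemma measurePreserving_move {k₁ k₂ k₃ : K} (h12 : k₁ ≠ k₂) (h13 : k₁ ≠ k₃) (h23 : k₂ ≠ k₃)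
    (hB : MeasurePreserving burke ((ν k₁).prod ((ν k₂).prod (ν k₃)))
      ((ν k₁).prod ((ν k₂).prod (ν k₃)))) :
    MeasurePreserving (move k₁ k₂ k₃) (Measure.infinitePi ν) (Measure.infinitePi ν) := by
  let μ := Measure.infinitePi ν
  let ν₃ := (ν k₁).prod ((ν k₂).prod (ν k₃))
  let U : (ℝ × ℝ × ℝ) × (K → ℝ) → K → ℝ := fun p =>
    Function.update (Function.update (Function.update p.2 k₃ p.1.2.2) k₂ p.1.2.1) k₁ p.1.1
  -- resampling the three coordinates by independent variables
  have hU : MeasurePreserving U (ν₃.prod μ) μ := by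
    have e1 : MeasurePreserving (fun p : (ℝ × ℝ × ℝ) × (K → ℝ) => (p.1.1, p.1.2, p.2))
        (ν₃.prod μ) ((ν k₁).prod (((ν k₂).prod (ν k₃)).prod μ)) :=
      measurePreserving_prodAssoc _ _ _
    have e2 : MeasurePreserving (fun p : (ℝ × ℝ) × (K → ℝ) => (p.1.1, p.1.2, p.2))
        (((ν k₂).prod (ν k₃)).prod μ) ((ν k₂).prod ((ν k₃).prod μ)) :=
      measurePreserving_prodAssoc _ _ _
    have e3 := (measurePreserving_update ν k₂).comp
      (((MeasurePreserving.id (ν k₂)).prod (measurePreserving_update ν k₃)).comp e2)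
    exact (measurePreserving_update ν k₁).comp (((MeasurePreserving.id (ν k₁)).prod e3).comp e1)
  have hcomp : move k₁ k₂ k₃ ∘ U = U ∘ Prod.map burke id := by
    funext ⟨⟨a, b, c⟩, D⟩
    funext k
    have u1 : U ((a, b, c), D) k₁ = a := by simp [U]
    have u2 : U ((a, b, c), D) k₂ = b := by simp [U, h12.symm]
    have u3 : U ((a, b, c), D) k₃ = c := by simp [U, h13.symm, h23.symm]
    simp only [Function.comp, move, u1, u2, u3]
    by_cases hk1 : k = k₁
    · subst hk1; simp [U, burke]
    by_cases hk2 : k = k₂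
    · subst hk2; simp [U, burke, hk1]
    by_cases hk3 : k = k₃
    · subst hk3; simp [U, burke, hk1, hk2]
    · simp [U, hk1, hk2, hk3]
  refine ⟨measurable_move _ _ _, ?_⟩
  change Measure.map _ μ = μ
  conv_lhs => rw [← hU.map_eq]
  rw [Measure.map_map (measurable_move _ _ _) hU.measurable, hcomp]
  exact (hU.comp (hB.prod (MeasurePreserving.id μ))).map_eq

end Product

section Coordinates

variable {K : Type*} (ν : K → Measure ℝ) [∀ k, IsProbabilityMeasure (ν k)]

/-- A family of random variables is independent as soon as each of its finite subfamilies can be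
carried into distinct coordinates of a product measure by a measure-preserving map. -/
lemma iIndepFun_of_finite_coordinates {ι : Type*} {X : ι → (K → ℝ) → ℝ} {e : ι → K}
    (he : Function.Injective e)
    (hX : ∀ F : Finset ι, ∃ Ψ : (K → ℝ) → K → ℝ,
      MeasurePreserving Ψ (Measure.infinitePi ν) (Measure.infinitePi ν) ∧
        ∀ i ∈ F, ∀ D, X i D = Ψ D (e i)) :
    iIndepFun X (Measure.infinitePi ν) ∧
      ∀ i, HasLaw (X i) (ν (e i)) (Measure.infinitePi ν) := by
  have hmp : ∀ k, MeasurePreserving (fun D : K → ℝ => D k) (Measure.infinitePi ν) (ν k) :=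
    fun k => measurePreserving_eval_infinitePi ν k
  constructor
  · have hco : iIndepFun (fun i (D : K → ℝ) => D (e i)) (Measure.infinitePi ν) :=
      (iIndepFun_infinitePi (P := ν) (X := fun _ => id) fun _ => measurable_id).precomp he
    rw [iIndepFun_iff_measure_inter_preimage_eq_mul] at hco ⊢
    intro S sets hs
    obtain ⟨Ψ, hΨ, h⟩ := hX S
    have key : ∀ i ∈ S, X i ⁻¹' sets i = Ψ ⁻¹' ((fun D : K → ℝ => D (e i)) ⁻¹' sets i) := by
      intro i hi; ext D; simp [h i hi D]
    have hms : ∀ i ∈ S, MeasurableSet ((fun D : K → ℝ => D (e i)) ⁻¹' sets i) :=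
      fun i hi => (measurable_pi_apply _) (hs i hi)
    rw [Set.iInter₂_congr key, ← Set.preimage_iInter₂,
      hΨ.measure_preimage (Finset.measurableSet_biInter S hms).nullMeasurableSet, hco S hs]
    refine Finset.prod_congr rfl fun i hi => ?_
    rw [key i hi, hΨ.measure_preimage (hms i hi).nullMeasurableSet]
  · intro i
    obtain ⟨Ψ, hΨ, h⟩ := hX {i}
    have : X i = (fun D : K → ℝ => D (e i)) ∘ Ψ := by
      funext D; exact h i (Finset.mem_singleton_self i) D
    rw [this]
    exact ⟨((hmp _).comp hΨ).measurable.aemeasurable, ((hmp _).comp hΨ).map_eq⟩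

/-- A map between product spaces preserves product measures as soon as finitely many of its
coordinates at a time can be realised by a measure-preserving map followed by a relabelling. -/
lemma measurePreserving_of_finite_coordinates {ι : Type*} {ν' : ι → Measure ℝ}
    {T : (K → ℝ) → ι → ℝ} (hT : Measurable T) {e : ι → K} (he : Function.Injective e)
    (hν : ∀ i, ν (e i) = ν' i)
    (hX : ∀ F : Finset ι, ∃ Ψ : (K → ℝ) → K → ℝ,
      MeasurePreserving Ψ (Measure.infinitePi ν) (Measure.infinitePi ν) ∧
        ∀ i ∈ F, ∀ D, T D i = Ψ D (e i)) :
    MeasurePreserving T (Measure.infinitePi ν) (Measure.infinitePi ν') := by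
  obtain ⟨h1, h2⟩ := iIndepFun_of_finite_coordinates ν (X := fun i D => T D i) he hX
  have h := h1.hasLaw_infinitePi h2 hT.aemeasurable
  simp only [hν] at h
  exact ⟨hT, h.map_eq⟩

/-- Functions of disjoint sets of coordinates are independent under a product measure. -/
lemma indepFun_of_disjoint_coordinates {S T : Set K} [DecidablePred (· ∈ S)]
    [DecidablePred (· ∈ T)] (hST : Disjoint S T) :
    IndepFun (fun (D : K → ℝ) k => if k ∈ S then D k else 0)
      (fun (D : K → ℝ) k => if k ∈ T then D k else 0) (Measure.infinitePi ν) := by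
  have hco : iIndepFun (fun i (D : K → ℝ) => D i) (Measure.infinitePi ν) :=
    iIndepFun_infinitePi (P := ν) (X := fun _ => id) fun _ => measurable_id
  have hind := indep_iSup_of_disjoint
    (m := fun k => MeasurableSpace.comap (fun D : K → ℝ => D k) inferInstance)
    (fun k => (measurable_pi_apply k).comap_le) hco hST
  have hle : ∀ (U : Set K) [DecidablePred (· ∈ U)],
      MeasurableSpace.comap (fun (D : K → ℝ) k => if k ∈ U then D k else 0) inferInstance ≤
        ⨆ k ∈ U, MeasurableSpace.comap (fun D : K → ℝ => D k) inferInstance := by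
    intro U _
    rw [MeasurableSpace.pi, MeasurableSpace.comap_iSup]
    refine iSup_le fun k => ?_
    rw [MeasurableSpace.comap_comp]
    by_cases hk : k ∈ U
    · have : (fun b : K → ℝ => b k) ∘ (fun (D : K → ℝ) k => if k ∈ U then D k else 0)
          = fun D => D k := by funext D; simp [hk]
      rw [this]
      exact le_iSup₂ (f := fun k (_ : k ∈ U) =>
        MeasurableSpace.comap (fun D : K → ℝ => D k) inferInstance) k hk
    · have : (fun b : K → ℝ => b k) ∘ (fun (D : K → ℝ) k => if k ∈ U then D k else 0)
          = fun _ => 0 := by funext D; simp [hk]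
      rw [this, MeasurableSpace.comap_const]
      exact bot_le
  exact indep_of_indep_of_le_left (indep_of_indep_of_le_right hind (hle T)) (hle S)

end Coordinates

/-! ### Queues -/

/-- Sojourn times of a queue with initial sojourn time `x`, arrivals `v` and services `w`. They are
also the horizontal increments along a column of last-passage percolation with weights `w`, where
`x` is the increment at the bottom and `v` lists the vertical increments of the column before. -/
noncomputable def sojourn (x : ℝ) (v w : ℕ → ℝ) : ℕ → ℝ
  | 0 => x
  | j + 1 => w j + max (sojourn x v w j - v j) 0

/-- Departures of the queue with initial sojourn time `x`, arrivals `v` and services `w`; the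
vertical increments of the new column in last-passage percolation. -/
noncomputable def departure (x : ℝ) (v w : ℕ → ℝ) (j : ℕ) : ℝ :=
  w j + max (v j - sojourn x v w j) 0

/-- Dual services of the queue with initial sojourn time `x`, arrivals `v` and services `w`. -/
noncomputable def dualService (x : ℝ) (v w : ℕ → ℝ) (j : ℕ) : ℝ :=
  min (v j) (sojourn x v w j)

lemma sojourn_congr {x : ℝ} {v w v' w' : ℕ → ℝ} {n : ℕ} (hv : ∀ j < n, v j = v' j)
    (hw : ∀ j < n, w j = w' j) : ∀ j ≤ n, sojourn x v w j = sojourn x v' w' j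
  | 0, _ => rfl
  | j + 1, hj => by
    simp only [sojourn]
    rw [hv j hj, hw j hj, sojourn_congr hv hw j (by lia)]

lemma departure_congr {x : ℝ} {v w v' w' : ℕ → ℝ} {n : ℕ} (hv : ∀ j < n, v j = v' j)
    (hw : ∀ j < n, w j = w' j) (j : ℕ) (hj : j < n) :
    departure x v w j = departure x v' w' j := by
  rw [departure, departure, hv j hj, hw j hj, sojourn_congr hv hw j hj.le]

lemma sojourn_succ_init (x : ℝ) (v w : ℕ → ℝ) (j : ℕ) :
    sojourn (sojourn x v w 1) (fun i => v (i + 1)) (fun i => w (i + 1)) j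
      = sojourn x v w (j + 1) := by
  induction j with
  | zero => rfl
  | succ j ih => rw [sojourn, ih]; rfl

lemma departure_succ_init (x : ℝ) (v w : ℕ → ℝ) (j : ℕ) :
    departure (sojourn x v w 1) (fun i => v (i + 1)) (fun i => w (i + 1)) j
      = departure x v w (j + 1) := by
  rw [departure, sojourn_succ_init, departure]

/-! ### Last-passage percolation by recursion -/

/-- Last-passage values in the quadrant with horizontal boundary weights `h`, vertical boundary
weights `v` and bulk weights `w`, where `w m n` sits at `(m + 1, n + 1)`. -/
noncomputable def grow (h v : ℕ → ℝ) (w : ℕ → ℕ → ℝ) : ℕ → ℕ → ℝ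
  | 0, 0 => 0
  | m + 1, 0 => grow h v w m 0 + h m
  | 0, n + 1 => grow h v w 0 n + v n
  | m + 1, n + 1 => w m n + max (grow h v w m (n + 1)) (grow h v w (m + 1) n)
termination_by m n => (m, n)

section Grow

variable (h v : ℕ → ℝ) (w : ℕ → ℕ → ℝ)

lemma grow_zero_zero : grow h v w 0 0 = 0 := by rw [grow]
lemma grow_succ_zero (m : ℕ) : grow h v w (m + 1) 0 = grow h v w m 0 + h m := by rw [grow]
lemma grow_zero_succ (n : ℕ) : grow h v w 0 (n + 1) = grow h v w 0 n + v n := by rw [grow]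
lemma grow_succ_succ (m n : ℕ) : grow h v w (m + 1) (n + 1) =
    w m n + max (grow h v w m (n + 1)) (grow h v w (m + 1) n) := by rw [grow]

lemma grow_swap (m n : ℕ) : grow h v w m n = grow v h (fun i j => w j i) n m := by
  induction m generalizing n with
  | zero =>
    induction n with
    | zero => rw [grow_zero_zero, grow_zero_zero]
    | succ n ih => rw [grow_zero_succ, grow_succ_zero, ih]
  | succ m ihm =>
    induction n with
    | zero => rw [grow_succ_zero, grow_zero_succ, ihm]
    | succ n ih => rw [grow_succ_succ, grow_succ_succ, ih, ihm, max_comm]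

lemma grow_congr {h h' v v' : ℕ → ℝ} {m n : ℕ} (hh : ∀ i < m, h i = h' i)
    (hv : ∀ j < n, v j = v' j) (i j : ℕ) (hi : i ≤ m) (hj : j ≤ n) :
    grow h v w i j = grow h' v' w i j := by
  induction i generalizing j with
  | zero =>
    induction j with
    | zero => rw [grow_zero_zero, grow_zero_zero]
    | succ j ih => rw [grow_zero_succ, grow_zero_succ, ih (by lia), hv j hj]
  | succ i ihi =>
    induction j with
    | zero => rw [grow_succ_zero, grow_succ_zero, ihi 0 (by lia) hj, hh i hi]
    | succ j ih => rw [grow_succ_succ, grow_succ_succ, ih (by lia), ihi _ (by lia) hj]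

/-- Passing from one column to the next is a queue: the vertical increments of the column arrive,
the horizontal increments are the sojourn times. -/
lemma grow_column_sojourn (m j : ℕ) :
    sojourn (h m) (fun i => grow h v w m (i + 1) - grow h v w m i) (w m) j
      = grow h v w (m + 1) j - grow h v w m j := by
  induction j with
  | zero => rw [sojourn, grow_succ_zero]; ring
  | succ j ih =>
    rw [sojourn, ih, grow_succ_succ]
    rcases le_total (grow h v w m (j + 1)) (grow h v w (m + 1) j) with hle | hle
    · rw [max_eq_left (by linarith), max_eq_right hle]; ring
    · rw [max_eq_right (by linarith), max_eq_left hle]; ring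

lemma grow_column_departure (m j : ℕ) :
    departure (h m) (fun i => grow h v w m (i + 1) - grow h v w m i) (w m) j
      = grow h v w (m + 1) (j + 1) - grow h v w (m + 1) j := by
  rw [departure, grow_column_sojourn, grow_succ_succ]
  rcases le_total (grow h v w m (j + 1)) (grow h v w (m + 1) j) with hle | hle
  · rw [max_eq_right (by linarith), max_eq_right hle]; ring
  · rw [max_eq_left (by linarith), max_eq_left hle]; ring

/-- Increments from `(1, 0)` are last-passage values, with the increments along the axes through
`(1, 0)` as boundary weights. -/
lemma grow_shift (m n : ℕ) :
    grow (fun i => h (i + 1)) (departure (h 0) v (w 0)) (fun i => w (i + 1)) m n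
      = grow h v w (m + 1) n - grow h v w 1 0 := by
  have hv : departure (h 0) v (w 0) =
      fun j => grow h v w 1 (j + 1) - grow h v w 1 j := by
    have : v = fun i => grow h v w 0 (i + 1) - grow h v w 0 i := by
      funext i; rw [grow_zero_succ]; ring
    funext j
    conv_lhs => rw [this]
    exact grow_column_departure h v w 0 j
  induction m generalizing n with
  | zero =>
    induction n with
    | zero => rw [grow_zero_zero]; ring
    | succ n ih => rw [grow_zero_succ, ih, hv]; ring
  | succ m ihm =>
    induction n with
    | zero => rw [grow_succ_zero, ihm, grow_succ_zero h v w (m + 1)]; ring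
    | succ n ih =>
      rw [grow_succ_succ, ihm, ih, grow_succ_succ h v w (m + 1), max_sub_sub_right]; ring

end Grow

/-! ### The intertwining of queues -/

/-- One step of the intertwining of two queues in tandem. Each side is piecewise linear, and the
identities hold for all reals, without sign conditions. -/
lemma intertwining_step (sg al om Ir Wr d : ℝ) :
    om + max (sg + max (al - (d + max (Wr - Ir) 0)) 0 - min Ir Wr) 0
        = om + max (sg - Ir) 0
          + max (min sg Ir + max (al - d) 0 - Wr) 0 ∧
    om + max (min Ir Wr - (sg + max (al - (d + max (Wr - Ir) 0)) 0)) 0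
        = min (om + max (Ir - sg) 0)
          (om + max (sg - Ir) 0 + max (Wr - (min sg Ir + max (al - d) 0)) 0) ∧
    sg + max (d + max (Wr - Ir) 0 - al) 0
        = min sg Ir + max (d - al) 0
          + max (om + max (sg - Ir) 0 + max (Wr - (min sg Ir + max (al - d) 0)) 0
            - (om + max (Ir - sg) 0)) 0 := by
  refine ⟨?_, ?_, ?_⟩ <;> grind

/-- **Intertwining.** The departures of the queue `(W, a, s)` run through a last-passage column
with bottom increment `s₀` agree with the departures of the queue started from `s₀ + (W - a₀)⁺`
whose services are `s` run through the column with bottom increment `s₀ + (a₀ - W)⁺`, and whose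
arrivals are `a` run through the dual weights of the former with bottom increment `min a₀ W`. -/
lemma departure_departure (W s₀ a₀ : ℝ) (a s w : ℕ → ℝ) :
    departure s₀ (departure W a s) w =
      departure (s₀ + max (W - a₀) 0)
        (departure (min a₀ W) a (dualService (s₀ + max (a₀ - W) 0) s w))
        (departure (s₀ + max (a₀ - W) 0) s w) := by
  set x := s₀ + max (a₀ - W) 0 with hx
  set b := dualService x s w with hb
  set d := sojourn (min a₀ W) a b with hd
  set Ir := sojourn x s w with hIr
  set Wr := sojourn (s₀ + max (W - a₀) 0) (departure (min a₀ W) a b) (departure x s w) with hWr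
  -- at each height, the queueing step maps (`arrival`, `sojourn`, `service`) of the left column and
  -- bottom edge to `(Ir, Wr, d)`; as the step is an involution, it can be read backwards
  have inv : ∀ j, sojourn s₀ (departure W a s) w j = min (Ir j) (Wr j) ∧
      sojourn W a s j = d j + max (Wr j - Ir j) 0 := by
    intro j
    induction j with
    | zero =>
      simp only [hd, hIr, hWr, sojourn, hx]
      constructor <;> grind
    | succ j ih =>
      obtain ⟨ih1, ih2⟩ := ih
      obtain ⟨-, h2, h3⟩ := intertwining_step (s j) (a j) (w j) (Ir j) (Wr j) (d j)
      have e1 : Ir (j + 1) = w j + max (Ir j - s j) 0 := rfl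
      have e2 : Wr (j + 1) = w j + max (s j - Ir j) 0
          + max (Wr j - (min (s j) (Ir j) + max (a j - d j) 0)) 0 := rfl
      have e3 : d (j + 1) = min (s j) (Ir j) + max (d j - a j) 0 := rfl
      rw [e1, e2, e3]
      constructor
      · rw [sojourn, ih1, departure, ih2]; exact h2
      · rw [sojourn, ih2]; exact h3
  funext j
  obtain ⟨ih1, ih2⟩ := inv j
  rw [departure, ih1, departure, ih2]
  exact (intertwining_step (s j) (a j) (w j) (Ir j) (Wr j) (d j)).1

/-! ### Sweeping a column of queueing updates -/

section Sweep

variable {K : Type*} [DecidableEq K]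

/-- The first `n` updates of a queue whose sojourn time is kept in the coordinate `p`, and whose
arrivals and services in the coordinates `q j` and `b j` are overwritten by departures and dual
services. -/
noncomputable def sweep (p : K) (q b : ℕ → K) : ℕ → (K → ℝ) → K → ℝ
  | 0 => id
  | n + 1 => move (q n) p (b n) ∘ sweep p q b n

variable {p : K} {q b : ℕ → K}

lemma measurePreserving_sweep {ν : K → Measure ℝ} [∀ k, IsProbabilityMeasure (ν k)]
    (hpq : ∀ j, p ≠ q j) (hpb : ∀ j, p ≠ b j) (hqb : ∀ i j, q i ≠ b j)
    (hB : ∀ j, MeasurePreserving burke ((ν (q j)).prod ((ν p).prod (ν (b j))))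
      ((ν (q j)).prod ((ν p).prod (ν (b j))))) (n : ℕ) :
    MeasurePreserving (sweep p q b n) (Measure.infinitePi ν) (Measure.infinitePi ν) := by
  induction n with
  | zero => exact MeasurePreserving.id _
  | succ n ih =>
    exact (measurePreserving_move ν (hpq n).symm (hqb n n) (hpb n) (hB n)).comp ih

lemma sweep_apply_of_ne (D : K → ℝ) {n : ℕ} {k : K} (hp : k ≠ p) (hq : ∀ j < n, k ≠ q j)
    (hb : ∀ j < n, k ≠ b j) : sweep p q b n D k = D k := by
  induction n with
  | zero => rfl
  | succ n ih =>
    simp only [sweep, Function.comp, move, hp, hq n (by lia), hb n (by lia), if_false]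
    exact ih (fun j hj => hq j (by lia)) fun j hj => hb j (by lia)

lemma sweep_apply (D : K → ℝ) (hpq : ∀ j, p ≠ q j) (hpb : ∀ j, p ≠ b j)
    (hqb : ∀ i j, q i ≠ b j) (hq : Function.Injective q) (hb : Function.Injective b) (n : ℕ) :
    sweep p q b n D p = sojourn (D p) (fun j => D (q j)) (fun j => D (b j)) n ∧
    (∀ j < n, sweep p q b n D (q j)
      = departure (D p) (fun j => D (q j)) (fun j => D (b j)) j) ∧
    (∀ j < n, sweep p q b n D (b j)
      = dualService (D p) (fun j => D (q j)) (fun j => D (b j)) j) := by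
  induction n with
  | zero => exact ⟨rfl, by simp, by simp⟩
  | succ n ih =>
    obtain ⟨ih1, ih2, ih3⟩ := ih
    have hqn : sweep p q b n D (q n) = D (q n) :=
      sweep_apply_of_ne D (hpq n).symm (fun j hj h => hj.ne' (hq h)) fun j _ => hqb n j
    have hbn : sweep p q b n D (b n) = D (b n) :=
      sweep_apply_of_ne D (hpb n).symm (fun j _ => (hqb j n).symm) fun j hj h => hj.ne' (hb h)
    refine ⟨?_, fun j hj => ?_, fun j hj => ?_⟩
    · simp only [sweep, Function.comp, move, hpq n, if_false, if_true, hqn, hbn, ih1, sojourn]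
    · rcases Nat.lt_succ_iff_lt_or_eq.mp hj with hj | rfl
      · have : q j ≠ q n := fun h => hj.ne (hq h)
        simp only [sweep, Function.comp, move, this, (hpq j).symm, hqb j n, if_false, ih2 j hj]
      · simp only [sweep, Function.comp, move, if_true, hqn, hbn, ih1, departure]
    · rcases Nat.lt_succ_iff_lt_or_eq.mp hj with hj | rfl
      · have : b j ≠ b n := fun h => hj.ne (hb h)
        simp only [sweep, Function.comp, move, this, (hpb j).symm, (hqb n j).symm, if_false,
          ih3 j hj]
      · simp only [sweep, Function.comp, move, (hpb j).symm, (hqb j j).symm, if_false, if_true,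
          hqn, ih1, dualService]

/-- The sweeps of the first `m` columns up to height `n` in last-passage percolation, with
horizontal increments kept in the coordinates `h i`, vertical ones in `v j` and bulk weights in
`b i j`. -/
noncomputable def sweeps (h v : ℕ → K) (b : ℕ → ℕ → K) (n : ℕ) : ℕ → (K → ℝ) → K → ℝ
  | 0 => id
  | m + 1 => sweep (h m) v (b m) n ∘ sweeps h v b n m

variable {h v : ℕ → K} {w : ℕ → ℕ → K}

lemma measurePreserving_sweeps {ν : K → Measure ℝ} [∀ k, IsProbabilityMeasure (ν k)]
    (hhv : ∀ i j, h i ≠ v j) (hhw : ∀ i i' j, h i ≠ w i' j) (hvw : ∀ j i j', v j ≠ w i j')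
    (hB : ∀ i j, MeasurePreserving burke ((ν (v j)).prod ((ν (h i)).prod (ν (w i j))))
      ((ν (v j)).prod ((ν (h i)).prod (ν (w i j))))) (n m : ℕ) :
    MeasurePreserving (sweeps h v w n m) (Measure.infinitePi ν) (Measure.infinitePi ν) := by
  induction m with
  | zero => exact MeasurePreserving.id _
  | succ m ih =>
    exact (measurePreserving_sweep (hhv m) (hhw m m) (fun i j => hvw i m j) (hB m) n).comp ih

/-- After the sweeps of an `m × n` rectangle, the coordinates of the boundary weights hold the
increments along the opposite sides of the rectangle. -/
lemma sweeps_apply (D : K → ℝ) (hh : Function.Injective h) (hv : Function.Injective v)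
    (hw : ∀ i i' j j', w i j = w i' j' → i = i' ∧ j = j')
    (hhv : ∀ i j, h i ≠ v j) (hhw : ∀ i i' j, h i ≠ w i' j) (hvw : ∀ j i j', v j ≠ w i j')
    (n m : ℕ) (G : ℕ → ℕ → ℝ)
    (hG : G = grow (fun i => D (h i)) (fun j => D (v j)) (fun i j => D (w i j))) :
    (∀ j < n, sweeps h v w n m D (v j) = G m (j + 1) - G m j) ∧
    (∀ i < m, sweeps h v w n m D (h i) = G (i + 1) n - G i n) ∧
    (∀ i ≥ m, sweeps h v w n m D (h i) = D (h i)) ∧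
    (∀ i ≥ m, ∀ j, sweeps h v w n m D (w i j) = D (w i j)) := by
  induction m with
  | zero =>
    refine ⟨fun j _ => ?_, by simp, fun _ _ => rfl, fun _ _ _ => rfl⟩
    rw [hG, grow_zero_succ]; simp [sweeps]
  | succ m ih =>
    obtain ⟨ih1, ih2, ih3, ih4⟩ := ih
    have hs := sweep_apply (sweeps h v w n m D) (hhv m) (hhw m m) (fun i j => hvw i m j) hv
      (fun j j' hj => (hw _ _ _ _ hj).2) n
    have c1 : ∀ j < n, sweeps h v w n m D (v j) = (fun i => G m (i + 1) - G m i) j := ih1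
    have c2 : ∀ j < n, sweeps h v w n m D (w m j) = (fun j => D (w m j)) j :=
      fun j _ => ih4 m le_rfl j
    refine ⟨fun j hj => ?_, fun i hi => ?_, fun i hi => ?_, fun i hi j => ?_⟩
    · rw [sweeps, Function.comp, hs.2.1 j hj, ih3 m le_rfl, departure_congr c1 c2 j hj, hG]
      exact grow_column_departure (fun i => D (h i)) (fun j => D (v j)) (fun i j => D (w i j)) m j
    · rcases Nat.lt_succ_iff_lt_or_eq.mp hi with hi | rfl
      · rw [sweeps, Function.comp, sweep_apply_of_ne _ (fun h' => hi.ne (hh h'))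
          (fun j _ => hhv i j) (fun j _ => hhw i m j), ih2 i hi]
      · rw [sweeps, Function.comp, hs.1, ih3 i le_rfl, sojourn_congr c1 c2 n le_rfl, hG]
        exact grow_column_sojourn (fun i => D (h i)) (fun j => D (v j)) (fun i j => D (w i j)) i n
    · rw [sweeps, Function.comp, sweep_apply_of_ne _ (fun h' => absurd (hh h') (by lia))
        (fun j _ => hhv i j) (fun j _ => hhw i m j), ih3 i (by lia)]
    · rw [sweeps, Function.comp, sweep_apply_of_ne _ (hhw m i j).symm
        (fun j' _ => (hvw j' i j).symm) (fun j' _ h' => absurd (hw _ _ _ _ h').1 (by lia)),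
        ih4 i (by lia)]

end Sweep

/-! ### The recursion for last-passage values with boundary -/

section Paths

variable {w : ℤ × ℤ → ℝ}

lemma IsUpRightPath.le {x y : ℤ × ℤ} {n : ℕ} {p : ℕ → ℤ × ℤ} (hp : IsUpRightPath x y n p) :
    x.1 ≤ y.1 ∧ x.2 ≤ y.2 ∧ (y.1 - x.1) + (y.2 - x.2) = n := by
  obtain ⟨h0, hn, hs⟩ := hp
  have : ∀ k ≤ n, x.1 ≤ (p k).1 ∧ x.2 ≤ (p k).2 ∧ ((p k).1 - x.1) + ((p k).2 - x.2) = k := by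
    intro k hk
    induction k with
    | zero => simp [h0]
    | succ k ih =>
      obtain ⟨i1, i2, i3⟩ := ih (by lia)
      rcases hs k (by lia) with h | h <;> rw [h] <;> simp [e1, e2] <;> lia
  rw [← hn]; exact this n le_rfl

/-- `c` bounds the weights of all up-right paths from `a` to `x`; this holds trivially when there
are no such paths. -/
def PathBound (w : ℤ × ℤ → ℝ) (c : ℝ) (a x : ℤ × ℤ) : Prop := ∀ s ∈ pathSums w a x, s ≤ c

lemma pathBound_of_not_le {c : ℝ} {a x : ℤ × ℤ} (h : ¬(a.1 ≤ x.1 ∧ a.2 ≤ x.2)) :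
    PathBound w c a x := by
  rintro s ⟨p, hp, -⟩
  exact absurd ⟨hp.le.1, hp.le.2.1⟩ h

lemma add_mem_pathSums {a y e : ℤ × ℤ} (he : e = e1 ∨ e = e2) {s : ℝ}
    (hs : s ∈ pathSums w a y) : s + w (y + e) ∈ pathSums w a (y + e) := by
  obtain ⟨p, hp, rfl⟩ := hs
  obtain ⟨l1, l2, l3⟩ := hp.le
  set n := norm1 (y - a) with hn
  have hN : norm1 (y + e - a) = n + 1 := by
    rcases he with rfl | rfl <;> simp [norm1, e1, e2] <;> lia
  refine ⟨fun k => if k ≤ n then p k else y + e, ?_, ?_⟩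
  · rw [hN]
    refine ⟨by simp [hp.1], by simp, fun k hk => ?_⟩
    rcases Nat.lt_succ_iff_lt_or_eq.mp hk with h | rfl
    · have h1 : k + 1 ≤ n := h
      simpa [h1, h.le] using hp.2.2 k h
    · rcases he with rfl | rfl <;> simp [hp.2.1]
  · rw [hN, Finset.sum_range_succ _ (n + 1)]
    congr 1
    · refine Finset.sum_congr rfl fun k hk => ?_
      simp [Nat.lt_succ_iff.mp (Finset.mem_range.mp hk)]
    · simp

/-- The bound `PathBound` propagates along the last step of a path. -/
lemma pathBound_iff {c : ℝ} {a x : ℤ × ℤ} : PathBound w c a x ↔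
    PathBound w (c - w x) a (x - e1) ∧ PathBound w (c - w x) a (x - e2) ∧
      (a = x → w x ≤ c) := by
  constructor
  · intro h
    refine ⟨fun s hs => ?_, fun s hs => ?_, ?_⟩
    · have := h _ (by simpa using add_mem_pathSums (Or.inl rfl) hs)
      linarith
    · have := h _ (by simpa using add_mem_pathSums (Or.inr rfl) hs)
      linarith
    · rintro rfl
      refine h _ ⟨fun _ => a, ⟨rfl, rfl, fun k hk => ?_⟩, ?_⟩
      · simp [norm1] at hk
      · simp [norm1]
  · rintro ⟨h1, h2, h3⟩ s ⟨p, hp, rfl⟩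
    obtain ⟨l1, l2, l3⟩ := hp.le
    generalize hN : norm1 (x - a) = N at hp l3
    obtain ⟨p0, pN, ps⟩ := hp
    cases N with
    | zero =>
      have : a = x := by rw [← p0, ← pN]
      simpa [pN] using h3 this
    | succ n =>
      rw [Finset.sum_range_succ, pN]
      have key : ∀ e, (e = e1 ∨ e = e2) → p (n + 1) = p n + e →
          PathBound w (c - w x) a (x - e) →
          ∑ k ∈ Finset.range (n + 1), w (p k) + w x ≤ c := by
        intro e he hpe hb
        have hpn : p n = x - e := by rw [← pN, hpe]; simp
        have hpath : IsUpRightPath a (x - e) n p := ⟨p0, hpn, fun k hk => ps k (by lia)⟩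
        obtain ⟨m1, m2, m3⟩ := hpath.le
        have hn : norm1 (x - e - a) = n := by
          simp only [norm1, Prod.fst_sub, Prod.snd_sub] at *; lia
        have := hb _ ⟨p, by rw [hn]; exact hpath, rfl⟩
        rw [hn] at this
        linarith
      rcases ps n (by lia) with h | h
      · exact key e1 (Or.inl rfl) h h1
      · exact key e2 (Or.inr rfl) h h2

lemma pathSums_nonempty {a x : ℤ × ℤ} (h1 : a.1 ≤ x.1) (h2 : a.2 ≤ x.2) :
    (pathSums w a x).Nonempty := by
  obtain ⟨i, hi⟩ := Int.le.dest h1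
  obtain ⟨j, hj⟩ := Int.le.dest h2
  have hN : norm1 (x - a) = i + j := by
    simp only [norm1, Prod.fst_sub, Prod.snd_sub]; lia
  refine ⟨_, fun k => a + (((min k i : ℕ) : ℤ), ((k - i : ℕ) : ℤ)), ⟨?_, ?_, fun k hk => ?_⟩, rfl⟩
  · simp
  · rw [hN]; ext <;> simp <;> lia
  · by_cases hki : k < i
    · left; ext <;> simp [e1] <;> lia
    · right; ext <;> simp [e2] <;> lia

lemma exists_pathBound (a : ℤ × ℤ) (n : ℕ) :
    ∀ x : ℤ × ℤ, (x.1 - a.1) + (x.2 - a.2) = n → ∃ c, PathBound w c a x := by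
  induction n with
  | zero =>
    intro x hx
    refine ⟨w x, pathBound_iff.mpr ⟨pathBound_of_not_le ?_, pathBound_of_not_le ?_, fun _ => le_rfl⟩⟩
    · simp [e1]; lia
    · simp [e2]; lia
  | succ n ih =>
    intro x hx
    obtain ⟨c1, hc1⟩ := ih (x - e1) (by simp [e1]; lia)
    obtain ⟨c2, hc2⟩ := ih (x - e2) (by simp [e2]; lia)
    refine ⟨max c1 c2 + w x, pathBound_iff.mpr ⟨fun s hs => ?_, fun s hs => ?_, ?_⟩⟩
    · have := hc1 s hs; have := le_max_left c1 c2; linarith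
    · have := hc2 s hs; have := le_max_right c1 c2; linarith
    · rintro rfl; lia

lemma lpp_le_iff {a x : ℤ × ℤ} (h1 : a.1 ≤ x.1) (h2 : a.2 ≤ x.2) {c : ℝ} :
    lpp w a x ≤ c ↔ PathBound w c a x := by
  obtain ⟨b, hb⟩ := exists_pathBound (w := w) a ((x.1 - a.1) + (x.2 - a.2)).toNat x (by lia)
  exact csSup_le_iff ⟨b, hb⟩ (pathSums_nonempty h1 h2)

end Paths

section Boundary

variable (w : ℤ × ℤ → ℝ) (I J : ℕ → ℝ) (u : ℤ × ℤ)

lemma grow_zero_right (h v : ℕ → ℝ) (w : ℕ → ℕ → ℝ) (m : ℕ) :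
    grow h v w m 0 = ∑ i ∈ Finset.range m, h i := by
  induction m with
  | zero => rw [grow_zero_zero]; rfl
  | succ m ih => rw [grow_succ_zero, ih, Finset.sum_range_succ]

lemma grow_zero_left (h v : ℕ → ℝ) (w : ℕ → ℕ → ℝ) (n : ℕ) :
    grow h v w 0 n = ∑ j ∈ Finset.range n, v j := by
  rw [grow_swap, grow_zero_right]

/-- The recursive last-passage values satisfy the variational formula over exit points, in the form
of a characterisation of their upper bounds. The exit points are not restricted to those from
which `u + (m, n)` can be reached, since `PathBound` is trivial for the others. -/
lemma grow_le_iff (m n : ℕ) (c : ℝ) :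
    grow I J (fun i j => w (u + ((i : ℤ) + 1, (j : ℤ) + 1))) m n ≤ c ↔
      (∀ k : ℕ, PathBound w (c - ∑ i ∈ Finset.range (k + 1), I i) (u + ((k : ℤ) + 1, 1))
        (u + ((m : ℤ), (n : ℤ)))) ∧
      (∀ l : ℕ, PathBound w (c - ∑ j ∈ Finset.range (l + 1), J j) (u + (1, (l : ℤ) + 1))
        (u + ((m : ℤ), (n : ℤ)))) ∧
      (n = 0 → ∑ i ∈ Finset.range m, I i ≤ c) ∧ (m = 0 → ∑ j ∈ Finset.range n, J j ≤ c) := by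
  have hno : ∀ (k l m n : ℤ) (c : ℝ), ¬(k ≤ m ∧ l ≤ n) →
      PathBound w c (u + (k, l)) (u + (m, n)) := by
    intro k l m n c h
    refine pathBound_of_not_le ?_
    simpa using h
  induction m generalizing n c with
  | zero =>
    rw [grow_zero_left]
    constructor
    · intro h
      exact ⟨fun k => hno _ _ _ _ _ (by push_cast; lia), fun l => hno _ _ _ _ _ (by push_cast; lia),
        by rintro rfl; simpa using h, fun _ => h⟩
    · rintro ⟨-, -, -, h⟩; exact h rfl
  | succ m ihm =>
    induction n generalizing c with
    | zero =>
      rw [grow_zero_right]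
      constructor
      · intro h
        exact ⟨fun k => hno _ _ _ _ _ (by push_cast; lia),
          fun l => hno _ _ _ _ _ (by push_cast; lia), fun _ => h, by simp⟩
      · rintro ⟨-, -, h, -⟩; exact h rfl
    | succ n ihn =>
      set x := u + (((m + 1 : ℕ) : ℤ), ((n + 1 : ℕ) : ℤ)) with hx
      have hx' : u + ((m : ℤ) + 1, (n : ℤ) + 1) = x := by simp [hx]
      have x1 : x - e1 = u + ((m : ℤ), ((n + 1 : ℕ) : ℤ)) := by
        rw [hx, e1]; ext <;> simp; ring
      have x2 : x - e2 = u + (((m + 1 : ℕ) : ℤ), (n : ℤ)) := by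
        rw [hx, e2]; ext <;> simp; ring
      have hI : ∀ k : ℕ, u + ((k : ℤ) + 1, (1 : ℤ)) = x ↔ k = m ∧ n = 0 := by
        intro k; rw [hx]; simp [Prod.ext_iff]
      have hJ : ∀ l : ℕ, u + ((1 : ℤ), (l : ℤ) + 1) = x ↔ m = 0 ∧ l = n := by
        intro k; rw [hx]; simp [Prod.ext_iff]
      have hle : grow I J (fun i j => w (u + ((i : ℤ) + 1, (j : ℤ) + 1))) (m + 1) (n + 1) ≤ c ↔
          grow I J (fun i j => w (u + ((i : ℤ) + 1, (j : ℤ) + 1))) m (n + 1) ≤ c - w x ∧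
          grow I J (fun i j => w (u + ((i : ℤ) + 1, (j : ℤ) + 1))) (m + 1) n ≤ c - w x := by
        rw [grow_succ_succ, hx', ← max_le_iff, le_sub_iff_add_le, add_comm]
      refine (hle.trans (and_congr (ihm (n + 1) (c - w x)) (ihn (c - w x)))).trans ?_
      have hs : ∀ S : ℝ, c - w x - S = c - S - w x := fun S => by ring
      simp only [← x1, ← x2, hs]
      constructor
      · rintro ⟨⟨a1, a2, a3, a4⟩, b1, b2, b3, b4⟩
        refine ⟨fun k => pathBound_iff.mpr ⟨a1 k, b1 k, fun h => ?_⟩,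
          fun l => pathBound_iff.mpr ⟨a2 l, b2 l, fun h => ?_⟩, by simp, by simp⟩
        · obtain ⟨rfl, hn⟩ := (hI k).mp h
          have := b3 hn; linarith
        · obtain ⟨hm, rfl⟩ := (hJ l).mp h
          have := a4 hm; linarith
      · rintro ⟨a, b, -, -⟩
        have a' := fun k => pathBound_iff.mp (a k)
        have b' := fun l => pathBound_iff.mp (b l)
        refine ⟨⟨fun k => (a' k).1, fun l => (b' l).1, by simp, fun h => ?_⟩,
          fun k => (a' k).2.1, fun l => (b' l).2.1, fun h => ?_, by simp⟩
        · have := (b' n).2.2 ((hJ n).mpr ⟨h, rfl⟩); linarith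
        · have := (a' m).2.2 ((hI m).mpr ⟨rfl, h⟩); linarith

/-- Last-passage values defined by exit points satisfy the recursion. -/
lemma blpp_eq_grow (m n : ℕ) : blpp w I J u (u + ((m : ℤ), (n : ℤ)))
    = grow I J (fun i j => w (u + ((i : ℤ) + 1, (j : ℤ) + 1))) m n := by
  rcases Nat.eq_zero_or_pos n with rfl | hn
  · simp [blpp, grow_zero_right]
  rcases Nat.eq_zero_or_pos m with rfl | hm
  · simp [blpp, grow_zero_left, hn.ne']
  refine eq_of_forall_ge_iff fun c => ?_
  rw [grow_le_iff]
  have : Nonempty (Fin m) := ⟨⟨0, hm⟩⟩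
  have : Nonempty (Fin n) := ⟨⟨0, hn⟩⟩
  have c1 : (u + ((m : ℤ), (n : ℤ))).1 - u.1 = m := by simp
  have c2 : (u + ((m : ℤ), (n : ℤ))).2 - u.2 = n := by simp
  have eI : ∀ k : ℤ, u + (k + 1) • e1 + e2 = u + (k + 1, 1) := by
    intro k; ext <;> simp [e1, e2]
  have eJ : ∀ l : ℤ, u + e1 + (l + 1) • e2 = u + (1, l + 1) := by
    intro k; ext <;> simp [e1, e2]
  rw [blpp, if_neg (by simp [hn.ne']), if_neg (by simp [hm.ne']), c1, c2, Int.toNat_natCast,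
    Int.toNat_natCast, max_le_iff, ciSup_le_iff (Set.finite_range _).bddAbove,
    ciSup_le_iff (Set.finite_range _).bddAbove]
  simp only [eI, eJ]
  constructor
  · rintro ⟨h1, h2⟩
    refine ⟨fun k => ?_, fun l => ?_, by lia, by lia⟩
    · by_cases hk : k < m
      · have := h1 ⟨k, hk⟩
        rw [← lpp_le_iff (by simp; lia) (by simp; lia)]
        linarith
      · exact pathBound_of_not_le (by simp; lia)
    · by_cases hl : l < n
      · have := h2 ⟨l, hl⟩
        rw [← lpp_le_iff (by simp; lia) (by simp; lia)]
        linarith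
      · exact pathBound_of_not_le (by simp; lia)
  · rintro ⟨h1, h2, -, -⟩
    refine ⟨fun k => ?_, fun l => ?_⟩
    · have := h1 k
      rw [← lpp_le_iff (by simp) (by simp; lia)] at this
      linarith
    · have := h2 l
      rw [← lpp_le_iff (by simp; lia) (by simp)] at this
      linarith

end Boundary

/-! ### The coupling -/

/-- Labels of the independent exponential variables behind the coupling: a sojourn time at the
corner, services and arrivals along the horizontal and the vertical axis, and bulk weights. -/
inductive Label
  | corner
  | hService (i : ℕ)
  | hArrival (i : ℕ)
  | vService (j : ℕ)
  | vArrival (j : ℕ)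
  | weight (i j : ℕ)
  deriving DecidableEq

open Label

/-- Two ordered parameters `0 < λ < ρ < 1`. -/
structure Params where
  lam : ℝ
  rho : ℝ
  lam_pos : 0 < lam
  lam_lt_rho : lam < rho
  rho_lt_one : rho < 1

namespace Params

/-- The rates of the independent exponential variables. -/
noncomputable def rate (θ : Params) : Label → ℝ
  | corner => θ.rho - θ.lam
  | hService _ => 1 - θ.lam
  | hArrival _ => 1 - θ.rho
  | vService _ => θ.rho
  | vArrival _ => θ.lam
  | weight _ _ => 1

lemma rate_pos (θ : Params) (k : Label) : 0 < θ.rate k := by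
  have := θ.lam_pos
  have := θ.lam_lt_rho
  have := θ.rho_lt_one
  cases k <;> simp only [rate] <;> linarith

instance (θ : Params) (k : Label) : IsProbabilityMeasure (expMeasure (θ.rate k)) :=
  isProbabilityMeasure_expMeasure (θ.rate_pos k)

/-- The law of the independent exponential variables. -/
noncomputable def law (θ : Params) : Measure (Label → ℝ) :=
  Measure.infinitePi fun k => expMeasure (θ.rate k)

instance (θ : Params) : IsProbabilityMeasure θ.law := by
  unfold law; infer_instance

/-- The parameters of the model reflected along the diagonal. -/
noncomputable def reflect (θ : Params) : Params where
  lam := 1 - θ.rho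
  rho := 1 - θ.lam
  lam_pos := by linarith [θ.rho_lt_one]
  lam_lt_rho := by linarith [θ.lam_lt_rho]
  rho_lt_one := by linarith [θ.lam_pos]

lemma reflect_reflect (θ : Params) : θ.reflect.reflect = θ := by
  cases θ; simp [reflect]

lemma measurePreserving_burke (θ : Params) {k₁ k₂ k₃ : Label} (h : θ.rate k₁ + θ.rate k₂ = θ.rate k₃) :
    MeasurePreserving StatLPP.burke
      ((expMeasure (θ.rate k₁)).prod ((expMeasure (θ.rate k₂)).prod (expMeasure (θ.rate k₃))))
      ((expMeasure (θ.rate k₁)).prod ((expMeasure (θ.rate k₂)).prod (expMeasure (θ.rate k₃)))) :=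
  StatLPP.measurePreserving_burke (θ.rate_pos _) (θ.rate_pos _) h

lemma measurePreserving_sweep (θ : Params) {p : Label} {q b : ℕ → Label}
    (hpq : ∀ j, p ≠ q j) (hpb : ∀ j, p ≠ b j) (hqb : ∀ i j, q i ≠ b j)
    (hr : ∀ j, θ.rate (q j) + θ.rate p = θ.rate (b j)) (n : ℕ) :
    MeasurePreserving (sweep p q b n) θ.law θ.law :=
  StatLPP.measurePreserving_sweep (ν := fun k => expMeasure (θ.rate k)) hpq hpb hqb
    (fun j => θ.measurePreserving_burke (hr j)) n

lemma measurePreserving_sweeps (θ : Params) {h v : ℕ → Label} {w : ℕ → ℕ → Label}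
    (hhv : ∀ i j, h i ≠ v j) (hhw : ∀ i i' j, h i ≠ w i' j) (hvw : ∀ j i j', v j ≠ w i j')
    (hr : ∀ i j, θ.rate (v j) + θ.rate (h i) = θ.rate (w i j)) (n m : ℕ) :
    MeasurePreserving (sweeps h v w n m) θ.law θ.law :=
  StatLPP.measurePreserving_sweeps (ν := fun k => expMeasure (θ.rate k)) hhv hhw hvw
    (fun i j => θ.measurePreserving_burke (hr i j)) n m

end Params

/-- The horizontal boundary increments with the larger parameter. -/
noncomputable def hDeparture (D : Label → ℝ) : ℕ → ℝ :=
  departure (D corner) (fun i => D (hArrival i)) (fun i => D (hService i))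

/-- The vertical boundary increments with the smaller parameter. -/
noncomputable def vDeparture (D : Label → ℝ) : ℕ → ℝ :=
  departure (D corner) (fun j => D (vArrival j)) (fun j => D (vService j))

/-- The last-passage values with the smaller parameter `λ`. -/
noncomputable def lamGrow (D : Label → ℝ) : ℕ → ℕ → ℝ :=
  grow (fun i => D (hService i)) (vDeparture D) (fun i j => D (weight i j))

/-- The last-passage values with the larger parameter `ρ`. -/
noncomputable def rhoGrow (D : Label → ℝ) : ℕ → ℕ → ℝ :=
  grow (hDeparture D) (fun j => D (vService j)) (fun i j => D (weight i j))

section Measurability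

variable {Ω : Type*} [MeasurableSpace Ω] {x : Ω → ℝ} {v w : Ω → ℕ → ℝ}

lemma measurable_sojourn (hx : Measurable x) (hv : ∀ j, Measurable fun o => v o j)
    (hw : ∀ j, Measurable fun o => w o j) (n : ℕ) :
    Measurable fun o => sojourn (x o) (v o) (w o) n := by
  induction n with
  | zero => exact hx
  | succ n ih => exact (hw n).add ((ih.sub (hv n)).max measurable_const)

lemma measurable_departure (hx : Measurable x) (hv : ∀ j, Measurable fun o => v o j)
    (hw : ∀ j, Measurable fun o => w o j) (n : ℕ) :
    Measurable fun o => departure (x o) (v o) (w o) n :=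
  (hw n).add (((hv n).sub (measurable_sojourn hx hv hw n)).max measurable_const)

lemma measurable_dualService (hx : Measurable x) (hv : ∀ j, Measurable fun o => v o j)
    (hw : ∀ j, Measurable fun o => w o j) (n : ℕ) :
    Measurable fun o => dualService (x o) (v o) (w o) n :=
  (hv n).min (measurable_sojourn hx hv hw n)

lemma measurable_grow {h : Ω → ℕ → ℝ} {b : Ω → ℕ → ℕ → ℝ}
    (hh : ∀ j, Measurable fun o => h o j) (hv : ∀ j, Measurable fun o => v o j)
    (hb : ∀ i j, Measurable fun o => b o i j) (m n : ℕ) :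
    Measurable fun o => grow (h o) (v o) (b o) m n := by
  induction m generalizing n with
  | zero =>
    simp only [grow_zero_left]
    exact Finset.measurable_sum _ fun j _ => hv j
  | succ m ihm =>
    induction n with
    | zero =>
      simp only [grow_succ_zero]
      exact (ihm 0).add (hh m)
    | succ n ih =>
      simp only [grow_succ_succ]
      exact (hb m n).add ((ihm (n + 1)).max ih)

end Measurability

lemma measurable_hDeparture (i : ℕ) : Measurable fun D => hDeparture D i :=
  measurable_departure (measurable_pi_apply _) (fun _ => measurable_pi_apply _)
    (fun _ => measurable_pi_apply _) i

lemma measurable_vDeparture (j : ℕ) : Measurable fun D => vDeparture D j :=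
  measurable_departure (measurable_pi_apply _) (fun _ => measurable_pi_apply _)
    (fun _ => measurable_pi_apply _) j

lemma measurable_lamGrow (m n : ℕ) : Measurable fun D => lamGrow D m n :=
  measurable_grow (fun _ => measurable_pi_apply _) measurable_vDeparture
    (fun _ _ => measurable_pi_apply _) m n

lemma measurable_rhoGrow (m n : ℕ) : Measurable fun D => rhoGrow D m n :=
  measurable_grow measurable_hDeparture (fun _ => measurable_pi_apply _)
    (fun _ _ => measurable_pi_apply _) m n

/-! ### Translations of the coupling -/

/-- The weights and boundary variables seen from the corner moved by `e₁`: the vertical services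
pass through the first column of weights, and the vertical arrivals pass through the dual weights
that this leaves behind. -/
noncomputable def shiftRight (D : Label → ℝ) : Label → ℝ
  | corner => sojourn (D corner) (fun i => D (hArrival i)) (fun i => D (hService i)) 1
  | hService i => D (hService (i + 1))
  | hArrival i => D (hArrival (i + 1))
  | vService j => departure (hDeparture D 0) (fun j => D (vService j)) (fun j => D (weight 0 j)) j
  | vArrival j => departure (min (D (hArrival 0)) (D corner)) (fun j => D (vArrival j))
      (dualService (hDeparture D 0) (fun j => D (vService j)) (fun j => D (weight 0 j))) j
  | weight i j => D (weight (i + 1) j)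

lemma measurable_shiftRight : Measurable shiftRight := by
  refine measurable_pi_lambda _ fun k => ?_
  cases k with
  | corner =>
    exact measurable_sojourn (x := fun D : Label → ℝ => D corner)
      (v := fun D i => D (hArrival i)) (w := fun D i => D (hService i)) (measurable_pi_apply _)
      (fun _ => measurable_pi_apply _) (fun _ => measurable_pi_apply _) 1
  | hService i => exact measurable_pi_apply _
  | hArrival i => exact measurable_pi_apply _
  | vService j =>
    exact measurable_departure (x := fun D : Label → ℝ => hDeparture D 0)
      (v := fun D j => D (vService j)) (w := fun D j => D (weight 0 j))
      (measurable_hDeparture 0) (fun _ => measurable_pi_apply _)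
      (fun _ => measurable_pi_apply _) j
  | vArrival j =>
    exact measurable_departure (x := fun D : Label → ℝ => min (D (hArrival 0)) (D corner))
      (v := fun D j => D (vArrival j))
      (w := fun D => dualService (hDeparture D 0) (fun j => D (vService j))
        (fun j => D (weight 0 j)))
      ((measurable_pi_apply _).min (measurable_pi_apply _)) (fun _ => measurable_pi_apply _)
      (measurable_dualService (measurable_hDeparture 0) (fun _ => measurable_pi_apply _)
        (fun _ => measurable_pi_apply _)) j
  | weight i j => exact measurable_pi_apply _

/-- The label that holds a variable of the translated configuration after the queueing updates. -/
def Label.right : Label → Label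
  | corner => corner
  | hService i => hService (i + 1)
  | hArrival i => hArrival (i + 1)
  | vService j => vService j
  | vArrival j => vArrival j
  | weight i j => weight (i + 1) j

lemma Label.right_injective : Function.Injective Label.right := by
  intro k l h
  cases k <;> cases l <;> simp_all [Label.right]

/-- The number of updates of a column after which a label has its final value. -/
def Label.height : Label → ℕ
  | vService j => j + 1
  | vArrival j => j + 1
  | _ => 0

/-- The coupling is stationary under the translation by `e₁`. -/
lemma measurePreserving_shiftRight (θ : Params) :
    MeasurePreserving shiftRight θ.law θ.law := by
  refine measurePreserving_of_finite_coordinates _ measurable_shiftRight Label.right_injective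
    (fun k => by cases k <;> rfl) fun F => ?_
  set n := F.sup Label.height
  -- the update of the boundary, then two sweeps of the first column
  have m1 : MeasurePreserving (move (hArrival 0) corner (hService 0)) θ.law θ.law :=
    measurePreserving_move _ (by simp) (by simp) (by simp)
      (θ.measurePreserving_burke (by simp only [Params.rate]; ring))
  have m2 : MeasurePreserving (sweep (hArrival 0) vService (weight 0) n) θ.law θ.law :=
    θ.measurePreserving_sweep (by simp) (by simp) (by simp)
      (fun j => by simp only [Params.rate]; ring) n
  have m3 : MeasurePreserving (sweep (hService 0) vArrival (weight 0) n) θ.law θ.law :=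
    θ.measurePreserving_sweep (by simp) (by simp) (by simp)
      (fun j => by simp only [Params.rate]; ring) n
  refine ⟨_, m3.comp (m2.comp m1), fun k hk D => ?_⟩
  have hn : k.height ≤ n := Finset.le_sup hk
  simp only [Function.comp]
  set D1 := move (hArrival 0) corner (hService 0) D with hD1
  have a1 : D1 corner
      = sojourn (D corner) (fun i => D (hArrival i)) (fun i => D (hService i)) 1 := rfl
  have a2 : D1 (hArrival 0) = hDeparture D 0 := rfl
  have a3 : D1 (hService 0) = min (D (hArrival 0)) (D corner) := rfl
  have a4 : ∀ l, l ≠ corner → l ≠ hArrival 0 → l ≠ hService 0 → D1 l = D l := by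
    intro l h1 h2 h3; simp [hD1, move, h1, h2, h3]
  set D2 := sweep (hArrival 0) vService (weight 0) n D1 with hD2
  have inj : ∀ c : ℕ → Label, (∀ i j, c i = c j → i = j) → Function.Injective c :=
    fun c hc i j h => hc i j h
  have b := sweep_apply (p := hArrival 0) (q := vService) (b := weight 0) D1 (by simp) (by simp)
    (by simp) (inj _ (by simp)) (inj _ (by simp)) n
  rw [← hD2] at b
  have b4 : ∀ l, l ≠ hArrival 0 → (∀ j, l ≠ vService j) → (∀ j, l ≠ weight 0 j) →
      D2 l = D1 l :=
    fun l h1 h2 h3 => sweep_apply_of_ne D1 h1 (fun j _ => h2 j) (fun j _ => h3 j)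
  have c := sweep_apply (p := hService 0) (q := vArrival) (b := weight 0) D2 (by simp) (by simp)
    (by simp) (inj _ (by simp)) (inj _ (by simp)) n
  have c4 : ∀ l, l ≠ hService 0 → (∀ j, l ≠ vArrival j) → (∀ j, l ≠ weight 0 j) →
      sweep (hService 0) vArrival (weight 0) n D2 l = D2 l :=
    fun l h1 h2 h3 => sweep_apply_of_ne D2 h1 (fun j _ => h2 j) (fun j _ => h3 j)
  have e1 : (fun j => D1 (vService j)) = fun j => D (vService j) := by
    funext j; exact a4 _ (by simp) (by simp) (by simp)
  have e2 : (fun j => D1 (weight 0 j)) = fun j => D (weight 0 j) := by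
    funext j; exact a4 _ (by simp) (by simp) (by simp)
  rw [e1, e2, a2] at b
  cases k with
  | corner =>
    rw [Label.right, c4 _ (by simp) (by simp) (by simp), b4 _ (by simp) (by simp) (by simp), a1,
      shiftRight]
  | hService i =>
    rw [Label.right, c4 _ (by simp) (by simp) (by simp), b4 _ (by simp) (by simp) (by simp),
      a4 _ (by simp) (by simp) (by simp), shiftRight]
  | hArrival i =>
    rw [Label.right, c4 _ (by simp) (by simp) (by simp), b4 _ (by simp) (by simp) (by simp),
      a4 _ (by simp) (by simp) (by simp), shiftRight]
  | vService j =>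
    rw [Label.right, c4 _ (by simp) (by simp) (by simp), b.2.1 j hn, shiftRight]
  | vArrival j =>
    rw [Label.right, c.2.1 j hn, b4 _ (by simp) (by simp) (by simp), a3, shiftRight]
    refine (departure_congr (n := n) (fun i _ => ?_) (fun i hi => ?_) j hn).symm
    · rw [b4 _ (by simp) (by simp) (by simp), a4 _ (by simp) (by simp) (by simp)]
    · exact b.2.2 i hi
  | weight i j =>
    rw [Label.right, c4 _ (by simp) (by simp) (by simp), b4 _ (by simp) (by simp) (by simp),
      a4 _ (by simp) (by simp) (by simp), shiftRight]

lemma hDeparture_shiftRight (D : Label → ℝ) (i : ℕ) :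
    hDeparture (shiftRight D) i = hDeparture D (i + 1) :=
  departure_succ_init (D corner) (fun i => D (hArrival i)) (fun i => D (hService i)) i

/-- The intertwining of queues makes the vertical `λ`-increments of the translated configuration
those of the `λ`-process along the next column. -/
lemma vDeparture_shiftRight (D : Label → ℝ) : vDeparture (shiftRight D)
    = departure (D (hService 0)) (vDeparture D) (fun j => D (weight 0 j)) :=
  (departure_departure (D corner) (D (hService 0)) (D (hArrival 0)) (fun j => D (vArrival j))
    (fun j => D (vService j)) (fun j => D (weight 0 j))).symm

lemma lamGrow_shiftRight (D : Label → ℝ) (m n : ℕ) :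
    lamGrow (shiftRight D) m n = lamGrow D (m + 1) n - lamGrow D 1 0 := by
  rw [lamGrow, vDeparture_shiftRight]
  exact grow_shift (fun i => D (hService i)) (vDeparture D) (fun i j => D (weight i j)) m n

lemma rhoGrow_shiftRight (D : Label → ℝ) (m n : ℕ) :
    rhoGrow (shiftRight D) m n = rhoGrow D (m + 1) n - rhoGrow D 1 0 := by
  rw [rhoGrow, funext (hDeparture_shiftRight D)]
  exact grow_shift (hDeparture D) (fun j => D (vService j)) (fun i j => D (weight i j)) m n

/-- The reflection of labels along the diagonal. -/
def Label.reflect : Label → Label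
  | corner => corner
  | hService i => vService i
  | hArrival i => vArrival i
  | vService j => hService j
  | vArrival j => hArrival j
  | weight i j => weight j i

lemma Label.reflect_injective : Function.Injective Label.reflect := by
  intro k l h
  cases k <;> cases l <;> simp_all [Label.reflect]

/-- The reflection of configurations along the diagonal, which exchanges the two parameters. -/
def reflection (D : Label → ℝ) : Label → ℝ := fun k => D k.reflect

lemma measurePreserving_reflection (θ : Params) :
    MeasurePreserving reflection θ.law θ.reflect.law := by
  refine measurePreserving_of_finite_coordinates _
    (measurable_pi_lambda _ fun k => measurable_pi_apply _) Label.reflect_injective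
    (fun k => ?_) fun F => ⟨id, MeasurePreserving.id _, fun k _ D => rfl⟩
  congr 1
  cases k <;> simp [Label.reflect, Params.rate, Params.reflect]

lemma lamGrow_reflection (D : Label → ℝ) (m n : ℕ) :
    lamGrow (reflection D) m n = rhoGrow D n m :=
  grow_swap _ _ _ m n

lemma rhoGrow_reflection (D : Label → ℝ) (m n : ℕ) :
    rhoGrow (reflection D) m n = lamGrow D n m :=
  grow_swap _ _ _ m n

/-- The configuration seen from the corner moved by `e₂`. -/
noncomputable def shiftUp (D : Label → ℝ) : Label → ℝ := reflection (shiftRight (reflection D))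

lemma measurePreserving_shiftUp (θ : Params) : MeasurePreserving shiftUp θ.law θ.law := by
  have h := (measurePreserving_reflection θ.reflect).comp
    ((measurePreserving_shiftRight θ.reflect).comp (measurePreserving_reflection θ))
  rwa [θ.reflect_reflect] at h

lemma lamGrow_shiftUp (D : Label → ℝ) (m n : ℕ) :
    lamGrow (shiftUp D) m n = lamGrow D m (n + 1) - lamGrow D 0 1 := by
  rw [shiftUp, lamGrow_reflection, rhoGrow_shiftRight, rhoGrow_reflection, rhoGrow_reflection]

lemma rhoGrow_shiftUp (D : Label → ℝ) (m n : ℕ) :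
    rhoGrow (shiftUp D) m n = rhoGrow D m (n + 1) - rhoGrow D 0 1 := by
  rw [shiftUp, rhoGrow_reflection, lamGrow_shiftRight, lamGrow_reflection, lamGrow_reflection]

/-- The configuration seen from the corner moved by `(m, n)`. -/
noncomputable def shift (m n : ℕ) (D : Label → ℝ) : Label → ℝ := shiftRight^[m] (shiftUp^[n] D)

lemma measurePreserving_shift (θ : Params) (m n : ℕ) :
    MeasurePreserving (shift m n) θ.law θ.law :=
  ((measurePreserving_shiftRight θ).iterate m).comp ((measurePreserving_shiftUp θ).iterate n)

lemma grow_iterate_shift {F : (Label → ℝ) → ℕ → ℕ → ℝ}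
    (h1 : ∀ D m n, F (shiftRight D) m n = F D (m + 1) n - F D 1 0)
    (h2 : ∀ D m n, F (shiftUp D) m n = F D m (n + 1) - F D 0 1)
    (h0 : ∀ D, F D 0 0 = 0) (m n : ℕ) (D : Label → ℝ) (a b : ℕ) :
    F (shift m n D) a b = F D (m + a) (n + b) - F D m n := by
  have hr : ∀ m D a b, F (shiftRight^[m] D) a b = F D (m + a) b - F D m 0 := by
    intro m
    induction m with
    | zero => intro D a b; simp [h0]
    | succ m ih =>
      intro D a b
      rw [Function.iterate_succ, Function.comp, ih, h1, h1,
        show m + 1 + a = m + a + 1 by ring]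
      ring
  have hu : ∀ n D a b, F (shiftUp^[n] D) a b = F D a (n + b) - F D 0 n := by
    intro n
    induction n with
    | zero => intro D a b; simp [h0]
    | succ n ih =>
      intro D a b
      rw [Function.iterate_succ, Function.comp, ih, h2, h2,
        show n + 1 + b = n + b + 1 by ring]
      ring
  rw [shift, hr, hu, hu, add_zero]
  ring

lemma lamGrow_shift (m n : ℕ) (D : Label → ℝ) (a b : ℕ) :
    lamGrow (shift m n D) a b = lamGrow D (m + a) (n + b) - lamGrow D m n :=
  grow_iterate_shift lamGrow_shiftRight lamGrow_shiftUp (fun _ => grow_zero_zero _ _ _) m n D a b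

lemma rhoGrow_shift (m n : ℕ) (D : Label → ℝ) (a b : ℕ) :
    rhoGrow (shift m n D) a b = rhoGrow D (m + a) (n + b) - rhoGrow D m n :=
  grow_iterate_shift rhoGrow_shiftRight rhoGrow_shiftUp (fun _ => grow_zero_zero _ _ _) m n D a b

/-! ### Independence and marginal laws of the increments -/

open Label

/-- Two families are jointly independent, with exponential laws, if finitely many of their members
at a time can be carried into two sequences of labels by a measure-preserving map. -/
lemma iIndepFun_elim (θ : Params) {A B : Type*} {X : A → (Label → ℝ) → ℝ}
    {Y : B → (Label → ℝ) → ℝ} {h v : ℕ → Label} (hh : Function.Injective h)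
    (hv : Function.Injective v) (hhv : ∀ i j, h i ≠ v j) {kA : A → ℕ} {kB : B → ℕ}
    (hA : Function.Injective kA) (hB : Function.Injective kB)
    (hΨ : ∀ N : ℕ, ∃ Ψ, MeasurePreserving Ψ θ.law θ.law ∧ ∀ D,
      (∀ a, kA a < N → X a D = Ψ D (h (kA a))) ∧ ∀ b, kB b < N → Y b D = Ψ D (v (kB b))) :
    iIndepFun (Sum.elim X Y) θ.law ∧
      (∀ a, HasLaw (X a) (expMeasure (θ.rate (h (kA a)))) θ.law) ∧
      ∀ b, HasLaw (Y b) (expMeasure (θ.rate (v (kB b)))) θ.law := by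
  have he : Function.Injective (Sum.elim (h ∘ kA) (v ∘ kB)) :=
    (hh.comp hA).sumElim (hv.comp hB) fun a b => hhv _ _
  have key := iIndepFun_of_finite_coordinates (fun k => expMeasure (θ.rate k))
    (X := Sum.elim X Y) he fun F => by
      obtain ⟨Ψ, hm, hD⟩ := hΨ (F.sup (Sum.elim kA kB) + 1)
      refine ⟨Ψ, hm, fun i hi D => ?_⟩
      have hlt := Nat.lt_succ_of_le (Finset.le_sup (f := Sum.elim kA kB) hi)
      rcases i with a | b
      · exact (hD D).1 a hlt
      · exact (hD D).2 b hlt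
  exact ⟨key.1, fun a => key.2 (Sum.inl a), fun b => key.2 (Sum.inr b)⟩

lemma toNat_injective {S : Set ℤ} {f : ℤ → ℤ} (hf : Function.Injective f)
    (h : ∀ i ∈ S, 0 ≤ f i) : Function.Injective fun i : S => (f i).toNat := by
  intro i j hij
  have hi := h i i.2
  have hj := h j j.2
  have hij' : (f i).toNat = (f j).toNat := hij
  exact Subtype.ext (hf (by lia))

section Increments

variable {u : ℤ × ℤ} {G : ℤ × ℤ → (Label → ℝ) → ℝ} {F : (Label → ℝ) → ℕ → ℕ → ℝ}

lemma incI_eq (hG : ∀ D (m n : ℕ), G (u + ((m : ℤ), (n : ℤ))) D = F D m n) {x : ℤ × ℤ}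
    {a b : ℕ} (h1 : x.1 = u.1 + a + 1) (h2 : x.2 = u.2 + b) (D : Label → ℝ) :
    incI G x D = F D (a + 1) b - F D a b := by
  have hx : x = u + (((a + 1 : ℕ) : ℤ), (b : ℤ)) := by ext <;> simp [h1, h2]; ring
  have hx' : x - e1 = u + ((a : ℤ), (b : ℤ)) := by ext <;> simp [h1, h2, e1]
  rw [incI, hx', hG, hx, hG]

lemma incJ_eq (hG : ∀ D (m n : ℕ), G (u + ((m : ℤ), (n : ℤ))) D = F D m n) {x : ℤ × ℤ}
    {a b : ℕ} (h1 : x.1 = u.1 + a) (h2 : x.2 = u.2 + b + 1) (D : Label → ℝ) :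
    incJ G x D = F D a (b + 1) - F D a b := by
  have hx : x = u + ((a : ℤ), ((b + 1 : ℕ) : ℤ)) := by ext <;> simp [h1, h2]; ring
  have hx' : x - e2 = u + ((a : ℤ), (b : ℤ)) := by ext <;> simp [h1, h2, e2]
  rw [incJ, hx', hG, hx, hG]

/-- The marginal property holds for a process that is compatible with the translations, once
its boundary increments can be carried by measure-preserving maps into labels `h i` and `v j` with
the right rates while leaving the bulk weights in place. -/
lemma marginalProperty (θ : Params) {α : ℝ} {h v : ℕ → Label} (hh : Function.Injective h)
    (hv : Function.Injective v) (hhv : ∀ i j, h i ≠ v j) (hhw : ∀ i i' j, h i ≠ weight i' j)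
    (hvw : ∀ j i j', v j ≠ weight i j') (rh : ∀ i, θ.rate (h i) = 1 - α)
    (rv : ∀ j, θ.rate (v j) = α) {H V : (Label → ℝ) → ℕ → ℝ}
    (hF : ∀ D, F D = grow (H D) (V D) fun i j => D (weight i j))
    (hG : ∀ D (m n : ℕ), G (u + ((m : ℤ), (n : ℤ))) D = F D m n)
    (hs : ∀ m n D a b, F (shift m n D) a b = F D (m + a) (n + b) - F D m n)
    (hΨ : ∀ N : ℕ, ∃ Ψ, MeasurePreserving Ψ θ.law θ.law ∧ ∀ D,
      (∀ k < N, Ψ D (h k) = H D k) ∧ (∀ k < N, Ψ D (v k) = V D k) ∧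
        ∀ i j, Ψ D (weight i j) = D (weight i j)) :
    MarginalProperty θ.law G u α := by
  intro x hx
  obtain ⟨m, hm⟩ := Int.le.dest hx.1
  obtain ⟨n, hn⟩ := Int.le.dest hx.2
  constructor
  -- after the translation to `x`, the increments are boundary increments
  · have key := iIndepFun_elim θ (X := fun i : Set.Ici (1 : ℤ) => incI G (x + (i : ℤ) • e1))
      (Y := fun j : Set.Ici (1 : ℤ) => incJ G (x + (j : ℤ) • e2)) hh hv hhv
      (kA := fun i => ((i : ℤ) - 1).toNat) (kB := fun j => ((j : ℤ) - 1).toNat)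
      (toNat_injective (f := fun i => i - 1) (fun i j hij => by dsimp only at hij; lia)
        fun i hi => by have := Set.mem_Ici.mp hi; lia)
      (toNat_injective (f := fun i => i - 1) (fun i j hij => by dsimp only at hij; lia)
        fun i hi => by have := Set.mem_Ici.mp hi; lia) fun N => by
        obtain ⟨Ψ, hΨm, hΨ⟩ := hΨ N
        refine ⟨_, hΨm.comp (measurePreserving_shift θ m n), fun D => ⟨?_, ?_⟩⟩
        · rintro ⟨i, hi⟩ hN
          obtain ⟨k, rfl⟩ := Int.le.dest (show (1 : ℤ) ≤ i from hi)
          simp only [add_sub_cancel_left, Int.toNat_natCast] at hN ⊢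
          have e : H (shift m n D) k = F (shift m n D) (k + 1) 0 - F (shift m n D) k 0 := by
            rw [hF, grow_succ_zero]; ring
          rw [Function.comp, (hΨ _).1 k hN, e, hs, hs,
            incI_eq hG (a := m + k) (b := n) (by simp [e1]; lia) (by simp [e1]; lia)]
          simp [add_assoc]
        · rintro ⟨j, hj⟩ hN
          obtain ⟨k, rfl⟩ := Int.le.dest (show (1 : ℤ) ≤ j from hj)
          simp only [add_sub_cancel_left, Int.toNat_natCast] at hN ⊢
          have e : V (shift m n D) k = F (shift m n D) 0 (k + 1) - F (shift m n D) 0 k := by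
            rw [hF, grow_zero_succ]; ring
          rw [Function.comp, (hΨ _).2.1 k hN, e, hs, hs,
            incJ_eq hG (a := m) (b := n + k) (by simp [e2]; lia) (by simp [e2]; lia)]
          simp [add_assoc]
    simpa only [IndepExp, rh, rv] using key
  -- sweeping the rectangle between `u` and `x` turns its south and west boundary increments into
  -- those on the north and east sides
  · have key := iIndepFun_elim θ
      (X := fun i : Set.Ico (0 : ℤ) (x.1 - u.1) => incI G (x - (i : ℤ) • e1))
      (Y := fun j : Set.Ico (0 : ℤ) (x.2 - u.2) => incJ G (x - (j : ℤ) • e2)) hh hv hhv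
      (kA := fun i => (x.1 - u.1 - 1 - i).toNat) (kB := fun j => (x.2 - u.2 - 1 - j).toNat)
      (toNat_injective (f := fun i => x.1 - u.1 - 1 - i) (fun i j hij => by dsimp only at hij; lia)
        fun i hi => by have := Set.mem_Ico.mp hi; lia)
      (toNat_injective (f := fun i => x.2 - u.2 - 1 - i) (fun i j hij => by dsimp only at hij; lia)
        fun i hi => by have := Set.mem_Ico.mp hi; lia) fun _ => by
        obtain ⟨Ψ, hΨm, hΨ⟩ := hΨ (max m n)
        refine ⟨_, (θ.measurePreserving_sweeps hhv hhw hvw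
          (fun i j => by rw [rh, rv]; simp [Params.rate]) n m).comp hΨm, fun D => ?_⟩
        have hFD : ∀ a ≤ m, ∀ b ≤ n, F D a b = grow (fun i => Ψ D (h i)) (fun j => Ψ D (v j))
            (fun i j => Ψ D (weight i j)) a b := by
          intro a ha b hb
          simp only [(hΨ D).2.2]
          rw [hF]
          exact grow_congr _ (m := m) (n := n) (fun i hi => ((hΨ D).1 i (by lia)).symm)
            (fun j hj => ((hΨ D).2.1 j (by lia)).symm) a b ha hb
        obtain ⟨s1, s2, -⟩ := sweeps_apply (h := h) (v := v) (w := weight) (Ψ D) hh hv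
          (by simp) hhv hhw hvw n m _ rfl
        constructor
        · rintro ⟨i, hi⟩ -
          have hi' : 0 ≤ i ∧ i < x.1 - u.1 := hi
          obtain ⟨k, hk⟩ := Int.le.dest (show (0 : ℤ) ≤ x.1 - u.1 - 1 - i by lia)
          have hkm : k < m := by lia
          simp only [← hk, zero_add, Int.toNat_natCast, Function.comp]
          rw [incI_eq hG (a := k) (b := n) (by simp [e1]; lia) (by simp [e1]; lia), s2 k hkm,
            hFD _ hkm n le_rfl, hFD _ hkm.le n le_rfl]
        · rintro ⟨j, hj⟩ -
          have hj' : 0 ≤ j ∧ j < x.2 - u.2 := hj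
          obtain ⟨k, hk⟩ := Int.le.dest (show (0 : ℤ) ≤ x.2 - u.2 - 1 - j by lia)
          have hkn : k < n := by lia
          simp only [← hk, zero_add, Int.toNat_natCast, Function.comp]
          rw [incJ_eq hG (a := m) (b := k) (by simp [e2]; lia) (by simp [e2]; lia), s1 k hkn,
            hFD m le_rfl _ hkn, hFD m le_rfl _ hkn.le]
    simpa only [IndepExp, rh, rv] using key

lemma sweep_vertical (D : Label → ℝ) (N : ℕ) :
    (∀ k < N, sweep corner vArrival vService N D (vArrival k) = vDeparture D k) ∧
    ∀ l, l ≠ corner → (∀ k, l ≠ vArrival k) → (∀ k < N, l ≠ vService k) →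
      sweep corner vArrival vService N D l = D l :=
  ⟨(sweep_apply D (by simp) (by simp) (by simp) (fun i j hij => by simpa using hij)
    (fun i j hij => by simpa using hij) N).2.1,
    fun l h1 h2 h3 => sweep_apply_of_ne D h1 (fun j _ => h2 j) h3⟩

lemma sweep_horizontal (D : Label → ℝ) (N : ℕ) :
    (∀ k < N, sweep corner hArrival hService N D (hArrival k) = hDeparture D k) ∧
    ∀ l, l ≠ corner → (∀ k, l ≠ hArrival k) → (∀ k < N, l ≠ hService k) →
      sweep corner hArrival hService N D l = D l :=
  ⟨(sweep_apply D (by simp) (by simp) (by simp) (fun i j hij => by simpa using hij)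
    (fun i j hij => by simpa using hij) N).2.1,
    fun l h1 h2 h3 => sweep_apply_of_ne D h1 (fun j _ => h2 j) h3⟩

lemma measurePreserving_sweep_vertical (θ : Params) (N : ℕ) :
    MeasurePreserving (sweep corner vArrival vService N) θ.law θ.law :=
  θ.measurePreserving_sweep (by simp) (by simp) (by simp)
    (fun j => by simp only [Params.rate]; ring) N

lemma measurePreserving_sweep_horizontal (θ : Params) (N : ℕ) :
    MeasurePreserving (sweep corner hArrival hService N) θ.law θ.law :=
  θ.measurePreserving_sweep (by simp) (by simp) (by simp)
    (fun j => by simp only [Params.rate]; ring) N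

lemma marginalProperty_lam (θ : Params)
    (hG : ∀ D (m n : ℕ), G (u + ((m : ℤ), (n : ℤ))) D = lamGrow D m n) :
    MarginalProperty θ.law G u θ.lam := by
  refine marginalProperty θ (h := hService) (v := vArrival) (fun i j hij => by simpa using hij)
    (fun i j hij => by simpa using hij) (by simp) (by simp) (by simp) (fun _ => rfl) (fun _ => rfl)
    (fun D => rfl) hG lamGrow_shift fun N =>
      ⟨_, measurePreserving_sweep_vertical θ N, fun D => ⟨fun k _ => ?_, ?_, fun i j => ?_⟩⟩
  · exact (sweep_vertical D N).2 _ (by simp) (by simp) (by simp)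
  · exact (sweep_vertical D N).1
  · exact (sweep_vertical D N).2 _ (by simp) (by simp) (by simp)

lemma marginalProperty_rho (θ : Params)
    (hG : ∀ D (m n : ℕ), G (u + ((m : ℤ), (n : ℤ))) D = rhoGrow D m n) :
    MarginalProperty θ.law G u θ.rho := by
  refine marginalProperty θ (h := hArrival) (v := vService) (fun i j hij => by simpa using hij)
    (fun i j hij => by simpa using hij) (by simp) (by simp) (by simp) (fun _ => rfl) (fun _ => rfl)
    (fun D => rfl) hG rhoGrow_shift fun N =>
      ⟨_, measurePreserving_sweep_horizontal θ N, fun D => ⟨?_, fun k _ => ?_, fun i j => ?_⟩⟩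
  · exact (sweep_horizontal D N).1
  · exact (sweep_horizontal D N).2 _ (by simp) (by simp) (by simp)
  · exact (sweep_horizontal D N).2 _ (by simp) (by simp) (by simp)

/-- Along a vertical line, the `λ`-increments up to a point are departures of a queue and the
`ρ`-increments above it are later services of the same queue. -/
lemma iIndepFun_vertical (θ : Params) {G' : ℤ × ℤ → (Label → ℝ) → ℝ}
    (hG : ∀ D (m n : ℕ), G (u + ((m : ℤ), (n : ℤ))) D = lamGrow D m n)
    (hG' : ∀ D (m n : ℕ), G' (u + ((m : ℤ), (n : ℤ))) D = rhoGrow D m n)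
    {x : ℤ × ℤ} (hx : u ≤ x) :
    iIndepFun (Sum.elim
      (fun j : Set.Icc (u.2 - x.2 + 1) (0 : ℤ) => incJ G (x + (j : ℤ) • e2))
      (fun j : Set.Ici (1 : ℤ) => incJ G' (x + (j : ℤ) • e2))) θ.law := by
  obtain ⟨m, hm⟩ := Int.le.dest hx.1
  obtain ⟨n, hn⟩ := Int.le.dest hx.2
  refine (iIndepFun_elim θ (h := vArrival) (v := vService)
    (fun i j hij => by simpa using hij) (fun i j hij => by simpa using hij) (by simp)
    (kA := fun j : Set.Icc (u.2 - x.2 + 1) (0 : ℤ) => (x.2 - u.2 - 1 + j).toNat)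
    (kB := fun j : Set.Ici (1 : ℤ) => (x.2 - u.2 - 1 + j).toNat)
    (toNat_injective (f := fun i => x.2 - u.2 - 1 + i) (fun i j hij => by dsimp only at hij; lia)
        fun i hi => by have := Set.mem_Icc.mp hi; lia)
    (toNat_injective (f := fun i => x.2 - u.2 - 1 + i) (fun i j hij => by dsimp only at hij; lia)
        fun i hi => by have := Set.mem_Ici.mp hi; lia) fun _ => ?_).1
  -- stopping the sweep at height `n` leaves the services above `x` untouched
  refine ⟨_, (measurePreserving_sweep_vertical θ n).comp (measurePreserving_shift θ m 0),
    fun D => ⟨?_, ?_⟩⟩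
  · rintro ⟨j, hj⟩ -
    have hj' : u.2 - x.2 + 1 ≤ j ∧ j ≤ 0 := hj
    obtain ⟨k, hk⟩ := Int.le.dest (show (0 : ℤ) ≤ x.2 - u.2 - 1 + j by lia)
    have hkn : k < n := by lia
    have e : vDeparture (shift m 0 D) k
        = lamGrow (shift m 0 D) 0 (k + 1) - lamGrow (shift m 0 D) 0 k := by
      rw [lamGrow, grow_zero_succ]; ring
    simp only [← hk, zero_add, Int.toNat_natCast, Function.comp]
    rw [(sweep_vertical _ n).1 k hkn, e, lamGrow_shift, lamGrow_shift,
      incJ_eq hG (a := m) (b := k) (by simp [e2]; lia) (by simp [e2]; lia)]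
    simp
  · rintro ⟨j, hj⟩ -
    have hj' : 1 ≤ j := hj
    obtain ⟨k, hk⟩ := Int.le.dest (show (0 : ℤ) ≤ x.2 - u.2 - 1 + j by lia)
    have hkn : n ≤ k := by lia
    have e : shift m 0 D (vService k)
        = rhoGrow (shift m 0 D) 0 (k + 1) - rhoGrow (shift m 0 D) 0 k := by
      rw [rhoGrow, grow_zero_succ]; ring
    simp only [← hk, zero_add, Int.toNat_natCast, Function.comp]
    rw [(sweep_vertical _ n).2 _ (by simp) (by simp) (by simp; lia), e, rhoGrow_shift,
      rhoGrow_shift, incJ_eq hG' (a := m) (b := k) (by simp [e2]; lia) (by simp [e2]; lia)]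
    simp

end Increments

lemma indepFun_boundary_weight (θ : Params) :
    IndepFun (fun (D : Label → ℝ) (i : ℕ) =>
        (D (hService i), vDeparture D i, hDeparture D i, D (vService i)))
      (fun (D : Label → ℝ) (p : ℕ × ℕ) => D (weight p.1 p.2)) θ.law := by
  classical
  let T : Set Label := Set.range fun p : ℕ × ℕ => weight p.1 p.2
  have h := indepFun_of_disjoint_coordinates (fun k => expMeasure (θ.rate k))
    (S := Tᶜ) (T := T) disjoint_compl_left
  have hφ : Measurable fun (D : Label → ℝ) (i : ℕ) =>
      (D (hService i), vDeparture D i, hDeparture D i, D (vService i)) :=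
    measurable_pi_lambda _ fun i => (measurable_pi_apply _).prodMk
      ((measurable_vDeparture i).prodMk ((measurable_hDeparture i).prodMk (measurable_pi_apply _)))
  have hψ : Measurable fun (D : Label → ℝ) (p : ℕ × ℕ) => D (weight p.1 p.2) :=
    measurable_pi_lambda _ fun p => measurable_pi_apply _
  have h' := h.comp hφ hψ
  have hT : ∀ k, k ∈ T ↔ ∃ i j, weight i j = k := fun k => by simp [T]
  convert h' using 1
  · funext D i
    simp [Function.comp, hDeparture, vDeparture, hT]
  · funext D p
    simp [Function.comp, hT]
  · rfl

end StatLPP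

open StatLPP in
theorem theorem3p1 (lam rho : ℝ) (hlam : 0 < lam) (hlr : lam < rho) (hrho : rho < 1)
    (u : ℤ × ℤ) :
    ∃ (Ω : Type) (_ : MeasurableSpace Ω) (P : Measure Ω) (_ : IsProbabilityMeasure P)
      (w : ℤ × ℤ → Ω → ℝ) (Ilam Jlam Irho Jrho : ℕ → Ω → ℝ),
      -- all weights are random variables
      (∀ x, Measurable (w x)) ∧
      (∀ i, Measurable (Ilam i) ∧ Measurable (Jlam i) ∧
        Measurable (Irho i) ∧ Measurable (Jrho i)) ∧
      -- the bulk weights are i.i.d. Exp(1)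
      iIndepFun (fun x : StatLPP.bulk u => w x) P ∧
      (∀ x : StatLPP.bulk u, HasLaw (w x) (expMeasure 1) P) ∧
      -- the coupled boundary weights are jointly independent of the bulk weights
      IndepFun (fun o (i : ℕ) => (Ilam i o, Jlam i o, Irho i o, Jrho i o))
        (fun o (x : StatLPP.bulk u) => w x o) P ∧
      -- joint stationarity of the increments
      (∀ v : ℤ × ℤ, u ≤ v →
        IdentDistrib
          (fun o (x : ℕ × ℕ) =>
            (StatLPP.field w Ilam Jlam u (v + ((x.1 : ℤ), (x.2 : ℤ))) o
                - StatLPP.field w Ilam Jlam u v o,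
              StatLPP.field w Irho Jrho u (v + ((x.1 : ℤ), (x.2 : ℤ))) o
                - StatLPP.field w Irho Jrho u v o))
          (fun o (x : ℕ × ℕ) =>
            (StatLPP.field w Ilam Jlam u (u + ((x.1 : ℤ), (x.2 : ℤ))) o,
              StatLPP.field w Irho Jrho u (u + ((x.1 : ℤ), (x.2 : ℤ))) o))
          P P) ∧
      -- independence along vertical lines
      (∀ x ∈ StatLPP.bulk u,
        iIndepFun (Sum.elim
          (fun j : Set.Icc (u.2 - x.2 + 1) (0 : ℤ) =>
            StatLPP.incJ (StatLPP.field w Ilam Jlam u) (x + (j : ℤ) • StatLPP.e2))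
          (fun j : Set.Ici (1 : ℤ) =>
            StatLPP.incJ (StatLPP.field w Irho Jrho u) (x + (j : ℤ) • StatLPP.e2))) P) ∧
      -- marginal property
      StatLPP.MarginalProperty P (StatLPP.field w Ilam Jlam u) u lam ∧
      StatLPP.MarginalProperty P (StatLPP.field w Irho Jrho u) u rho := by
  let θ : Params := ⟨lam, rho, hlam, hlr, hrho⟩
  -- outside the bulk the truncation makes `index` meaningless, but no weight is used there
  let index : ℤ × ℤ → ℕ × ℕ := fun x => ((x.1 - u.1 - 1).toNat, (x.2 - u.2 - 1).toNat)
  let w : ℤ × ℤ → (Label → ℝ) → ℝ := fun x D => D (.weight (index x).1 (index x).2)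
  have hw : ∀ (D : Label → ℝ), (fun i j : ℕ => w (u + ((i : ℤ) + 1, (j : ℤ) + 1)) D)
      = fun i j => D (.weight i j) := by
    intro D; funext i j; simp [w, index]
  have hinj : Function.Injective fun x : bulk u => Label.weight (index x).1 (index x).2 := by
    rintro ⟨x, hx1, hx2⟩ ⟨y, hy1, hy2⟩ hxy
    simp only [index, Label.weight.injEq] at hxy
    ext <;> simp <;> lia
  have hL : ∀ D (m n : ℕ), field w (fun i D => D (.hService i)) (fun j D => vDeparture D j) u
      (u + ((m : ℤ), (n : ℤ))) D = lamGrow D m n := by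
    intro D m n
    rw [field, blpp_eq_grow, hw, lamGrow]
  have hR : ∀ D (m n : ℕ), field w (fun i D => hDeparture D i) (fun j D => D (.vService j)) u
      (u + ((m : ℤ), (n : ℤ))) D = rhoGrow D m n := by
    intro D m n
    rw [field, blpp_eq_grow, hw, rhoGrow]
  obtain ⟨hind, hlaw⟩ := iIndepFun_of_finite_coordinates (fun k => expMeasure (θ.rate k))
    (X := fun x : bulk u => w x) hinj fun F => ⟨id, MeasurePreserving.id _, fun _ _ _ => rfl⟩
  refine ⟨Label → ℝ, inferInstance, θ.law, inferInstance, w, fun i D => D (.hService i),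
    fun j D => vDeparture D j, fun i D => hDeparture D i, fun j D => D (.vService j),
    fun x => measurable_pi_apply _,
    fun i => ⟨measurable_pi_apply _, measurable_vDeparture i, measurable_hDeparture i,
      measurable_pi_apply _⟩, hind, hlaw, ?_, ?_, ?_, marginalProperty_lam θ hL,
    marginalProperty_rho θ hR⟩
  · exact (indepFun_boundary_weight θ).comp measurable_id
      (ψ := fun (b : ℕ × ℕ → ℝ) (x : bulk u) => b (index x))
      (measurable_pi_lambda _ fun x => measurable_pi_apply _)
  · intro v hv
    obtain ⟨m, hm⟩ := Int.le.dest hv.1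
    obtain ⟨n, hn⟩ := Int.le.dest hv.2
    have hv' : v = u + ((m : ℤ), (n : ℤ)) := by ext <;> simp [hm, hn]
    have hadd : ∀ a b : ℕ, u + ((m : ℤ), (n : ℤ)) + ((a : ℤ), (b : ℤ))
        = u + (((m + a : ℕ) : ℤ), ((n + b : ℕ) : ℤ)) := by
      intro a b; ext <;> simp [add_assoc]
    subst hv'
    simp only [hadd, hL, hR, ← lamGrow_shift, ← rhoGrow_shift]
    -- the increments from `v` are the values from `u` of the translated configuration
    have hmeas : Measurable fun (D : Label → ℝ) (x : ℕ × ℕ) =>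
        (lamGrow D x.1 x.2, rhoGrow D x.1 x.2) :=
      measurable_pi_lambda _ fun x => (measurable_lamGrow _ _).prodMk (measurable_rhoGrow _ _)
    have hmp := measurePreserving_shift θ m n
    refine ⟨(hmeas.comp hmp.measurable).aemeasurable, hmeas.aemeasurable, ?_⟩
    conv_rhs => rw [← hmp.map_eq, Measure.map_map hmeas hmp.measurable]
    rfl
  · intro x hx
    exact iIndepFun_vertical θ hL hR ⟨hx.1.le, hx.2.le⟩
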